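/- Call $A\subseteq\mathbb R^n$ *analytic* if, for some $J,L\ge 1$, $A=\{x : x\in X_j^+,\ g_j^+(x)>0\ (j\le J),\ x\in X_l^-,\ g_l^-(x)\le 0\ (l\le L)\}$ for real-analytic functions $g_j^+:X_j^+\to\mathbb R$, $g_l^-:X_l^-\to\mathbb R$ on open sets $X_j^+,X_l^-\subseteq\mathbb R^n$. A function $h:X\to\mathbb R^m$ with $X\subseteq\mathbb R^n$ is *PAP* (piecewise analytic under analytic partition) if $X$ has a countable partition into analytic sets $A^i$ such that $h=f^i$ on $A^i$ for some analytic $f^i$ defined on an open set containing $A^i$. Given lengths $\ell_1,\ell_2,\dots$, start with $[0,1]$ and at step $k\ge 1$ remove from the middle of each of the $2^{k-1}$ remaining closed intervals an open interval of length $\ell_k$; number the intervals removed at step $k$ from left to right by $i=1,\dots,2^{k-1}$. * For $\lambda\in(0,1]$, the *$\lambda$-Cantor function* $\phi_\lambda:(0,1)\to(0,1)$ is the continuous extension of the function equal to $(2i-1)/2^k$ on the $i$-th interval removed at step $k$, where $\ell_k=\lambda/3^k$. * $f:(0,1)\to(0,1)$ is the inverse of $x\mapsto\frac12(\phi_1(x)+x)$.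 The function $g:(0,1)\to[0,1]$ is $2^{-k}\bigl[1-(y-\frac{r+l}2)^2/(\frac{r-l}2)^2\bigr]$ on each interval $(l,r)$ removed at step $k$ for $\ell_k=3^{-k}$, and $0$ elsewhere. * *Volterra's function* $V$ on $(0,1)$, for given $(\ell_k)$, vanishes off the removed intervals. On a removed interval $(a,b)$, let $c$ be the largest critical point in $(0,\frac{b-a}2]$ of $s(y)=y^2\sin(1/y)$; then $V(x)=s(x-a)$ for $x\le a+c$, $V(x)=s(c)$ for $a+c\le x\le b-c$, and $V(x)=s(b-x)$ for $x\ge b-c$. Here $\ell_k=4^{-k}$ (the Smith–Volterra–Cantor set) or $\ell_k=\lambda/3^k$ with $\lambda\in(0,1)$. **Proposition.** Each of the functions $\phi_\lambda$ ($\lambda\in(0,1]$), $f$, $g$ and $V$ (for each of these choices of $\ell_k$) is continuous on $(0,1)$ and differentiable almost everywhere on $(0,1)$, but is not PAP. In particular, some continuous, almost-everywhere differentiable functions are not PAP. Moreover: 1. for $h=\phi_\lambda$ with $\lambda\in(0,1)$, for $h=f$ and for $h=V$, the set of $x\in(0,1)$ at which $h'$ is undefined or discontinuous (as a function on the set where it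 is defined) has positive measure; 2. for $h=\phi_1$ and $h=g$, the set of $x\in(0,1)$ at which $h$ is not differentiable is uncountable. -/

import Mathlib

open MeasureTheory Set

namespace PAP

/-! ## Piecewise analytic functions under analytic partition -/

section General

variable {E F : Type*} [NormedAddCommGroup E] [NormedSpace ℝ E]
  [NormedAddCommGroup F] [NormedSpace ℝ F]

/-- A set is analytic if it is cut out by finitely many conditions `g > 0` and finitely many
conditions `g ≤ 0`, each `g` being an analytic function on some open domain. -/
def IsAnalyticSet (A : Set E) : Prop :=
  ∃ (J L : ℕ) (_ : 0 < J) (_ : 0 < L)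
    (Up : Fin J → Set E) (gp : Fin J → E → ℝ) (Um : Fin L → Set E) (gm : Fin L → E → ℝ),
    (∀ j, IsOpen (Up j) ∧ AnalyticOnNhd ℝ (gp j) (Up j)) ∧
    (∀ l, IsOpen (Um l) ∧ AnalyticOnNhd ℝ (gm l) (Um l)) ∧
    A = {x | (∀ j, x ∈ Up j ∧ 0 < gp j x) ∧ (∀ l, x ∈ Um l ∧ gm l x ≤ 0)}

/-- `{A i}` is an analytic partition of `X`. -/
structure IsAnalyticPartition {ι : Type} (X : Set E) (A : ι → Set E) : Prop where
  disjoint : Pairwise fun i j => Disjoint (A i) (A j)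
  cover : ⋃ i, A i = X
  analytic : ∀ i, IsAnalyticSet (A i)

/-- `{⟨A i, f i⟩}` is a PAP representation of `h : X → F`, the function `f i` being analytic on
the open domain `U i ⊇ A i`. -/
structure IsPAPRepresentation {ι : Type} (X : Set E) (h : E → F)
    (A U : ι → Set E) (f : ι → E → F) : Prop where
  partition : IsAnalyticPartition X A
  isOpen_dom : ∀ i, IsOpen (U i)
  subset_dom : ∀ i, A i ⊆ U i
  analytic : ∀ i, AnalyticOnNhd ℝ (f i) (U i)
  eval : ∀ i, ∀ x ∈ A i, h x = f i x

/-- `h : X → F` is PAP (piecewise analytic under analytic partition): it has a PAP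
representation with countably many pieces. Only the values of `h` on `X` matter. -/
def IsPAP (X : Set E) (h : E → F) : Prop :=
  ∃ (ι : Type) (_ : Countable ι) (_ : Nonempty ι) (A U : ι → Set E) (f : ι → E → F),
    IsPAPRepresentation X h A U f

end General

/-! ## Differentiability on an open set of reals -/

/-- `h` is differentiable at almost every point of `X`. -/
def AEDifferentiableOn (X : Set ℝ) (h : ℝ → ℝ) : Prop :=
  ∀ᵐ x ∂(volume.restrict X), DifferentiableAt ℝ h x

/-- The points of `X` where `h` is not differentiable. -/
def nondiffSet (X : Set ℝ) (h : ℝ → ℝ) : Set ℝ :=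
  {x | x ∈ X ∧ ¬ DifferentiableAt ℝ h x}

/-- The points of `X` where `h'` is undefined, or defined but discontinuous; here `h'` is
regarded as a function on the set of those points of `X` where it is defined. -/
def derivDefectSet (X : Set ℝ) (h : ℝ → ℝ) : Set ℝ :=
  {x | x ∈ X ∧ (¬ DifferentiableAt ℝ h x ∨
    ¬ ContinuousWithinAt (deriv h) {y | y ∈ X ∧ DifferentiableAt ℝ h y} x)}

/-! ## Cantor-type constructions

Start with `[0,1]`; at step `k ≥ 1` remove from the middle of each remaining closed interval an
open interval of length `ℓ k`. All indices `i` below start at `0`. -/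

/-- The length of each of the `2 ^ k` closed intervals that remain after step `k`. -/
noncomputable def remLength (ℓ : ℕ → ℝ) : ℕ → ℝ
  | 0 => 1
  | k + 1 => (remLength ℓ k - ℓ (k + 1)) / 2

/-- The left endpoint of the `i`-th (`i < 2 ^ k`) closed interval that remains after step `k`;
the `i`-th interval splits into the intervals `2 * i` and `2 * i + 1` of the next step. -/
noncomputable def remLeft (ℓ : ℕ → ℝ) : ℕ → ℕ → ℝ
  | 0, _ => 0
  | k + 1, i => remLeft ℓ k (i / 2) + if i % 2 = 0 then 0 else remLength ℓ (k + 1) + ℓ (k + 1)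

/-- The left endpoint of the `i`-th (`i < 2 ^ k`) open interval removed at step `k + 1`. -/
noncomputable def gapLeft (ℓ : ℕ → ℝ) (k i : ℕ) : ℝ := remLeft ℓ k i + remLength ℓ (k + 1)

/-- The right endpoint of the `i`-th (`i < 2 ^ k`) open interval removed at step `k + 1`. -/
noncomputable def gapRight (ℓ : ℕ → ℝ) (k i : ℕ) : ℝ := gapLeft ℓ k i + ℓ (k + 1)

/-- The `i`-th (`i < 2 ^ k`) open interval removed at step `k + 1`. -/
def gap (ℓ : ℕ → ℝ) (k i : ℕ) : Set ℝ := Ioo (gapLeft ℓ k i) (gapRight ℓ k i)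

/-- The union of all removed intervals. -/
def gapUnion (ℓ : ℕ → ℝ) : Set ℝ := {x | ∃ k i : ℕ, i < 2 ^ k ∧ x ∈ gap ℓ k i}

open Classical in
/-- The function equal to `v k i` on the `i`-th interval removed at step `k + 1`, and to `0` off
all removed intervals. -/
noncomputable def gapwise (ℓ : ℕ → ℝ) (v : ℕ → ℕ → ℝ → ℝ) (x : ℝ) : ℝ :=
  if h : ∃ p : ℕ × ℕ, p.2 < 2 ^ p.1 ∧ x ∈ gap ℓ p.1 p.2 then
    v h.choose.1 h.choose.2 x
  else 0

theorem remLeft_child {ℓ : ℕ → ℝ} (hℓ : ∀ k, 0 < ℓ (k + 1)) (hr : ∀ k, 0 < remLength ℓ k)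
    {x : ℝ} {k i : ℕ} (h : x ∈ Icc (remLeft ℓ (k + 1) i) (remLeft ℓ (k + 1) i
      + remLength ℓ (k + 1))) :
    x ∈ Icc (remLeft ℓ k (i / 2)) (remLeft ℓ k (i / 2) + remLength ℓ k) ∧
      x ∉ gap ℓ k (i / 2) := by
  have e : remLength ℓ (k + 1) = (remLength ℓ k - ℓ (k + 1)) / 2 := rfl
  have h1 := hℓ k
  have h2 := hr (k + 1)
  simp only [remLeft, mem_Icc] at h
  simp only [gap, gapLeft, gapRight, mem_Icc, mem_Ioo, not_and, not_lt]
  split_ifs at h <;> exact ⟨⟨by linarith, by linarith⟩, fun _ => by linarith⟩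

theorem rem_unique {ℓ : ℕ → ℝ} (hℓ : ∀ k, 0 < ℓ (k + 1)) (hr : ∀ k, 0 < remLength ℓ k)
    {x : ℝ} (k : ℕ) : ∀ i j : ℕ, i < 2 ^ k → j < 2 ^ k →
      x ∈ Icc (remLeft ℓ k i) (remLeft ℓ k i + remLength ℓ k) →
      x ∈ Icc (remLeft ℓ k j) (remLeft ℓ k j + remLength ℓ k) → i = j := by
  induction k with
  | zero => intro i j hi hj _ _; simp at hi hj; omega
  | succ k ih =>
    intro i j hi hj hxi hxj
    have hij : i / 2 = j / 2 := ih _ _ (by rw [pow_succ] at hi; omega)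
      (by rw [pow_succ] at hj; omega) (remLeft_child hℓ hr hxi).1 (remLeft_child hℓ hr hxj).1
    have h1 := hℓ k
    simp only [remLeft, mem_Icc, hij] at hxi hxj
    by_contra hne
    split_ifs at hxi hxj <;> first | omega | linarith [hxi.1, hxi.2, hxj.1, hxj.2]

theorem gap_subset_rem {ℓ : ℕ → ℝ} (hr : ∀ k, 0 < remLength ℓ k) {x : ℝ} {k i : ℕ}
    (h : x ∈ gap ℓ k i) : x ∈ Icc (remLeft ℓ k i) (remLeft ℓ k i + remLength ℓ k) := by
  have e : remLength ℓ (k + 1) = (remLength ℓ k - ℓ (k + 1)) / 2 := rfl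
  have h2 := hr (k + 1)
  simp only [gap, gapLeft, gapRight, mem_Ioo] at h
  exact ⟨by linarith [h.1], by linarith [h.2]⟩

theorem rem_ancestor {ℓ : ℕ → ℝ} (hℓ : ∀ k, 0 < ℓ (k + 1)) (hr : ∀ k, 0 < remLength ℓ k)
    {x : ℝ} {k : ℕ} (m : ℕ) : ∀ j : ℕ, j < 2 ^ (k + m) →
      x ∈ Icc (remLeft ℓ (k + m) j) (remLeft ℓ (k + m) j + remLength ℓ (k + m)) →
      ∃ i < 2 ^ k, x ∈ Icc (remLeft ℓ k i) (remLeft ℓ k i + remLength ℓ k) := by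
  induction m with
  | zero => intro j hj h; exact ⟨j, hj, h⟩
  | succ m ih =>
    intro j hj h
    exact ih (j / 2) (by rw [← add_assoc, pow_succ] at hj; omega) (remLeft_child hℓ hr h).1

theorem gap_not_later {ℓ : ℕ → ℝ} (hℓ : ∀ k, 0 < ℓ (k + 1)) (hr : ∀ k, 0 < remLength ℓ k)
    {x : ℝ} {k i k' i' : ℕ} (hi : i < 2 ^ k) (hi' : i' < 2 ^ k') (h : x ∈ gap ℓ k i)
    (h' : x ∈ gap ℓ k' i') : ¬ k < k' := by
  intro hlt
  obtain ⟨m, rfl⟩ := Nat.exists_eq_add_of_le (Nat.succ_le_of_lt hlt)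
  obtain ⟨j, hj, hxj⟩ := rem_ancestor hℓ hr m i' hi' (gap_subset_rem hr h')
  have hc := remLeft_child hℓ hr hxj
  have hij : i = j / 2 := rem_unique hℓ hr k _ _ hi
    (by rw [Nat.succ_eq_add_one, pow_succ] at hj; omega) (gap_subset_rem hr h) hc.1
  exact hc.2 (hij ▸ h)

/-- The removed intervals are disjoint, so that `gapwise` is well defined. -/
theorem gapwise_eq {ℓ : ℕ → ℝ} (hℓ : ∀ k, 0 < ℓ (k + 1)) (hr : ∀ k, 0 < remLength ℓ k)
    (v : ℕ → ℕ → ℝ → ℝ) {x : ℝ} {k i : ℕ} (hi : i < 2 ^ k) (h : x ∈ gap ℓ k i) :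
    gapwise ℓ v x = v k i x := by
  have hex : ∃ p : ℕ × ℕ, p.2 < 2 ^ p.1 ∧ x ∈ gap ℓ p.1 p.2 := ⟨(k, i), hi, h⟩
  obtain ⟨c1, c2⟩ := hex.choose_spec
  have hk : hex.choose.1 = k := le_antisymm (not_lt.1 (gap_not_later hℓ hr hi c1 h c2))
    (not_lt.1 (gap_not_later hℓ hr c1 hi c2 h))
  rw [hk] at c1 c2
  have hi' : hex.choose.2 = i :=
    rem_unique hℓ hr k _ _ c1 hi (gap_subset_rem hr c2) (gap_subset_rem hr h)
  rw [gapwise, dif_pos hex, hk, hi']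

/-! ### The `lam`-Cantor functions -/

/-- At step `k` of the construction of the `lam`-Cantor set, the length removed is
`lam / 3 ^ k`. -/
noncomputable def cantorLen (lam : ℝ) (k : ℕ) : ℝ := lam / 3 ^ k

/-- The `lam`-Cantor function: equal to `(2 * i + 1) / 2 ^ (k + 1)` on the `i`-th interval removed
at step `k + 1` (`i = 0, …, 2 ^ k - 1`), and extended by continuity from the union of these
intervals. -/
noncomputable def cantorFunction (lam : ℝ) : ℝ → ℝ :=
  extendFrom (gapUnion (cantorLen lam))
    (gapwise (cantorLen lam) fun k i _ => (2 * (i : ℝ) + 1) / 2 ^ (k + 1))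

/-! ### A pair of functions whose composition is not almost everywhere differentiable -/

/-- The inverse on `(0,1)` of the map `x ↦ (φ x + x) / 2`, with `φ` the `1`-Cantor function. -/
noncomputable def fClaim1 : ℝ → ℝ :=
  Function.invFunOn (fun x => (cantorFunction 1 x + x) / 2) (Ioo 0 1)

/-- On each interval `(l, r)` removed at step `k + 1` of the construction of the `1`-Cantor set,
the parabola with height `1 / 2 ^ (k + 1)` vanishing at `l` and `r`; zero elsewhere. -/
noncomputable def gClaim1 : ℝ → ℝ :=
  gapwise (cantorLen 1) fun k i y =>
    let l := gapLeft (cantorLen 1) k i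
    let r := gapRight (cantorLen 1) k i
    (1 / 2 ^ (k + 1)) * (1 - (y - (r + l) / 2) ^ 2 / ((r - l) / 2) ^ 2)

/-! ### Volterra's function -/

/-- The function `y ^ 2 * sin (1 / y)`, with value `0` at `0`. -/
noncomputable def volterraOsc (y : ℝ) : ℝ := y ^ 2 * Real.sin (1 / y)

/-- The largest critical point of `y ^ 2 * sin (1 / y)` in `(0, d / 2]`. -/
noncomputable def volterraCut (d : ℝ) : ℝ :=
  sSup {y | 0 < y ∧ y ≤ d / 2 ∧ deriv volterraOsc y = 0}

/-- Volterra's function for the Cantor-type set with removed lengths `ℓ`. It vanishes off the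
removed intervals. On a removed interval `(a, b)`, with `c` the largest critical point of
`y ^ 2 * sin (1 / y)` up to the half-length of the interval, it is `y ^ 2 * sin (1 / y)` with
`y = x - a` on `(a, a + c]`, constant on `[a + c, b - c]`, and the mirror image on `[b - c, b)`. -/
noncomputable def volterraFunction (ℓ : ℕ → ℝ) : ℝ → ℝ :=
  gapwise ℓ fun k i x =>
    let a := gapLeft ℓ k i
    let b := gapRight ℓ k i
    let c := volterraCut (b - a)
    if x ≤ a + c then volterraOsc (x - a)
    else if x ≤ b - c then volterraOsc c
    else volterraOsc (b - x)

/-- The removed lengths `1 / 4 ^ k` of the Smith-Volterra-Cantor set. -/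
noncomputable def svcLen (k : ℕ) : ℝ := 1 / 4 ^ k

end PAP

namespace PAP
open Filter Topology

/-! ## Points of non-analyticity of a PAP function -/

/-! A point of an analytic set `A ⊆ ℝ` outside the interior of `A` is an isolated zero of one of the
functions in the conditions `g ≤ 0`, and a function has only countably many isolated zeros. So a PAP
function on a set of reals is analytic at all but countably many of its points, and a defect set of
positive measure or an uncountable set of non-differentiability rules PAP out.

Positive measure: let `x` correspond to a point off the removed intervals. Near `x` the derivative
takes some value `c` on removed intervals, while at `x` it is either undefined or different from `c`
(`mem_derivDefectSet_of_frequently`). For the fat Cantor functions `c = 0` against a slope at least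
1; for `f`, `c = 2` against 0; for `V`, `c = -1` against 0. Such `x` have positive measure because
the removed intervals, or their images in the case of `f`, have total length below 1
(`volume_pos_of_cover`).

Uncountability: at each point of the classical Cantor set in `(0,1)`, difference quotients of `φ₁`
and `g` at scale `3⁻ᵏ` are of order at least `(3/2)ᵏ`.

The Cantor functions are handled through `stairs`, a supremum that is visibly monotone and whose
values at the endpoints of all remaining intervals are explicit dyadics. Almost everywhere
differentiability is Lebesgue's theorem for the monotone functions; `g` is smooth on gaps of full
measure, and `V` can fail to be differentiable only at countably many cut points. -/

/-- These points form a discrete subspace, and every subset of `ℝ` is Lindelöf. -/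
theorem countable_isolated_zeros (U : Set ℝ) (g : ℝ → ℝ) :
    {x | x ∈ U ∧ g x = 0 ∧ ∀ᶠ y in 𝓝[≠] x, g y ≠ 0}.Countable := by
  refine (HereditarilyLindelofSpace.isLindelof _).countable ?_
  rw [discreteTopology_subtype_iff]
  rintro x ⟨-, -, hx⟩
  rw [← disjoint_iff, Filter.disjoint_principal_right]
  filter_upwards [hx] with y hy hy'
  exact hy hy'.2.1

/-- Strict inequalities persist near a point. Where some `gm l` vanishes, it either vanishes
identically nearby, so the condition persists too, or has an isolated zero there. -/
theorem IsAnalyticSet.countable_diff_interior {A : Set ℝ} (hA : IsAnalyticSet A) :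
    (A \ interior A).Countable := by
  obtain ⟨J, L, -, -, Up, gp, Um, gm, hp, hm, rfl⟩ := hA
  refine (countable_iUnion fun l => countable_isolated_zeros (Um l) (gm l)).mono ?_
  rintro x ⟨⟨hxp, hxm⟩, hxi⟩
  by_contra hx
  simp only [mem_iUnion, mem_ofPred_eq, not_exists, not_and] at hx
  refine hxi (mem_interior_iff_mem_nhds.2 ?_)
  have h1 : ∀ᶠ y in 𝓝 x, ∀ j, y ∈ Up j ∧ 0 < gp j y := by
    refine eventually_all.2 fun j => Filter.Eventually.and ((hp j).1.mem_nhds (hxp j).1) ?_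
    exact ((hp j).2 x (hxp j).1).continuousAt.eventually (lt_mem_nhds (hxp j).2)
  have h2 : ∀ᶠ y in 𝓝 x, ∀ l, y ∈ Um l ∧ gm l y ≤ 0 := by
    refine eventually_all.2 fun l => Filter.Eventually.and ((hm l).1.mem_nhds (hxm l).1) ?_
    have ha := (hm l).2 x (hxm l).1
    rcases (hxm l).2.lt_or_eq with h | h
    · exact (ha.continuousAt.eventually (gt_mem_nhds h)).mono fun y hy => le_of_lt hy
    · rcases ha.eventually_eq_zero_or_eventually_ne_zero with h0 | h0
      · exact h0.mono fun y hy => hy.le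
      · exact absurd h0 (hx l (hxm l).1 h)
  filter_upwards [h1, h2] with y a b using ⟨a, b⟩

/-- A PAP function on a set of reals is analytic at all but countably many points of the set. -/
theorem IsPAP.countable_not_analyticAt {X : Set ℝ} {h : ℝ → ℝ} (hh : IsPAP X h) :
    {x | x ∈ X ∧ ¬ AnalyticAt ℝ h x}.Countable := by
  obtain ⟨ι, _, _, A, U, f, H⟩ := hh
  refine (countable_iUnion fun i => (H.partition.analytic i).countable_diff_interior).mono ?_
  rintro x ⟨hx, hna⟩
  rw [← H.partition.cover] at hx
  obtain ⟨i, hi⟩ := mem_iUnion.1 hx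
  refine mem_iUnion.2 ⟨i, hi, fun hint => hna ?_⟩
  refine (H.analytic i x (H.subset_dom i hi)).congr ?_
  filter_upwards [mem_interior_iff_mem_nhds.1 hint] with y hy using (H.eval i y hy).symm

theorem IsPAP.countable_nondiffSet {X : Set ℝ} {h : ℝ → ℝ} (hh : IsPAP X h) :
    (nondiffSet X h).Countable := by
  refine hh.countable_not_analyticAt.mono ?_
  exact fun _ hx => ⟨hx.1, fun ha => hx.2 ha.differentiableAt⟩

theorem IsPAP.countable_derivDefectSet {X : Set ℝ} {h : ℝ → ℝ} (hh : IsPAP X h) :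
    (derivDefectSet X h).Countable := by
  refine hh.countable_not_analyticAt.mono ?_
  refine fun x hx => ⟨hx.1, fun ha => ?_⟩
  rcases hx.2 with h1 | h1
  · exact h1 ha.differentiableAt
  · exact h1 ha.deriv.continuousAt.continuousWithinAt

theorem not_isPAP_of_derivDefectSet {X : Set ℝ} {h : ℝ → ℝ}
    (hpos : 0 < volume (derivDefectSet X h)) : ¬ IsPAP X h := fun hh =>
  hpos.ne' (hh.countable_derivDefectSet.measure_zero _)

/-! ## Two facts on derivatives -/

/-- The linearisation errors at `a n` and `b n` are small multiples of the distances to `x`; since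
`x` lies between, these distances add up to `b n - a n`. -/
theorem _root_.HasDerivAt.tendsto_straddle {f : ℝ → ℝ} {f' x : ℝ} (hf : HasDerivAt f f' x)
    {a b : ℕ → ℝ} (ha : Tendsto a atTop (𝓝 x)) (hb : Tendsto b atTop (𝓝 x))
    (hax : ∀ n, a n ≤ x) (hxb : ∀ n, x ≤ b n) (hab : ∀ n, a n < b n) :
    Tendsto (fun n => (f (b n) - f (a n)) / (b n - a n)) atTop (𝓝 f') := by
  rw [hasDerivAt_iff_isLittleO] at hf
  rw [Metric.tendsto_atTop']
  intro ε hε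
  have h := hf.def (half_pos hε)
  obtain ⟨N, hN⟩ := eventually_atTop.1 ((ha.eventually h).and (hb.eventually h))
  refine ⟨N, fun n hn => ?_⟩
  obtain ⟨h1, h2⟩ := hN n hn.le
  have hpos : 0 < b n - a n := sub_pos.2 (hab n)
  simp only [smul_eq_mul, Real.norm_eq_abs] at h1 h2
  rw [abs_of_nonpos (sub_nonpos.2 (hax n))] at h1
  rw [abs_of_nonneg (sub_nonneg.2 (hxb n))] at h2
  rw [Real.dist_eq, div_sub' hpos.ne', abs_div, abs_of_pos hpos]
  rw [div_lt_iff₀ hpos]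
  rw [abs_le] at h1 h2
  have : ε / 2 * (b n - a n) < ε * (b n - a n) := by nlinarith
  rw [abs_lt]
  constructor <;> nlinarith [h1.1, h1.2, h2.1, h2.2]

theorem mem_derivDefectSet_of_frequently {X : Set ℝ} {h : ℝ → ℝ} {x c : ℝ} (hx : x ∈ X)
    (hc : DifferentiableAt ℝ h x → deriv h x ≠ c)
    (hf : ∀ ε > 0, ∃ y ∈ X, |y - x| < ε ∧ HasDerivAt h c y) : x ∈ derivDefectSet X h := by
  refine ⟨hx, ?_⟩
  by_cases hd : DifferentiableAt ℝ h x
  · refine Or.inr fun hcont => ?_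
    have hev := hcont.eventually (isOpen_ne.mem_nhds (hc hd))
    rw [eventually_iff, Metric.mem_nhdsWithin_iff] at hev
    obtain ⟨ε, hε, hsub⟩ := hev
    obtain ⟨y, hyX, hy, hdy⟩ := hf ε hε
    exact hsub ⟨hy, hyX, hdy.differentiableAt⟩ hdy.deriv
  · exact Or.inl hd

/-! ## Geometry of the Cantor-type constructions -/

/-- The lengths removed are positive and, at every step, leave intervals of positive length. -/
structure IsCantorLength (ℓ : ℕ → ℝ) : Prop where
  pos : ∀ k, 0 < ℓ (k + 1)
  rem_pos : ∀ k, 0 < remLength ℓ k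

theorem remLength_succ (ℓ : ℕ → ℝ) (k : ℕ) :
    remLength ℓ (k + 1) = (remLength ℓ k - ℓ (k + 1)) / 2 := rfl

theorem remLeft_two_mul (ℓ : ℕ → ℝ) (k i : ℕ) : remLeft ℓ (k + 1) (2 * i) = remLeft ℓ k i := by
  simp [remLeft]

theorem remLeft_two_mul_add_one (ℓ : ℕ → ℝ) (k i : ℕ) :
    remLeft ℓ (k + 1) (2 * i + 1) = gapRight ℓ k i := by
  have : (2 * i + 1) / 2 = i := by omega
  simp [remLeft, gapRight, gapLeft, this, add_assoc]

theorem gapRight_add (ℓ : ℕ → ℝ) (k i : ℕ) :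
    gapRight ℓ k i + remLength ℓ (k + 1) = remLeft ℓ k i + remLength ℓ k := by
  rw [gapRight, gapLeft]; linarith [remLength_succ ℓ k]

/-- Leftmost descendants keep the left endpoint, so intervals from different steps can be compared
at a common one. -/
theorem remLeft_mul_two_pow (ℓ : ℕ → ℝ) (k i m : ℕ) :
    remLeft ℓ (k + m) (i * 2 ^ m) = remLeft ℓ k i := by
  induction m with
  | zero => simp
  | succ m ih => rw [← ih, ← remLeft_two_mul ℓ (k + m), ← add_assoc]; congr 1; ring

theorem remRight_last (ℓ : ℕ → ℝ) (k i m : ℕ) :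
    remLeft ℓ (k + m) ((i + 1) * 2 ^ m - 1) + remLength ℓ (k + m)
      = remLeft ℓ k i + remLength ℓ k := by
  induction m with
  | zero => simp
  | succ m ih =>
    have h : (i + 1) * 2 ^ (m + 1) - 1 = 2 * ((i + 1) * 2 ^ m - 1) + 1 := by
      have : 0 < (i + 1) * 2 ^ m := by positivity
      rw [pow_succ, ← mul_assoc]; omega
    rw [h, ← add_assoc k, remLeft_two_mul_add_one, gapRight_add, ih]

theorem exists_gap_of_mem_gapUnion {ℓ : ℕ → ℝ} {x : ℝ} (hx : x ∈ gapUnion ℓ) :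
    ∃ k i : ℕ, i < 2 ^ k ∧ x ∈ gap ℓ k i := hx

theorem gapwise_of_notMem {ℓ : ℕ → ℝ} (v : ℕ → ℕ → ℝ → ℝ) {x : ℝ} (hx : x ∉ gapUnion ℓ) :
    gapwise ℓ v x = 0 := by
  rw [gapwise, dif_neg]
  rintro ⟨⟨k, i⟩, hi, h⟩
  exact hx ⟨k, i, hi, h⟩

theorem exists_rem {ℓ : ℕ → ℝ} {x : ℝ} (hx : x ∈ Icc (0 : ℝ) 1) (hg : x ∉ gapUnion ℓ) (k : ℕ) :
    ∃ i < 2 ^ k, x ∈ Icc (remLeft ℓ k i) (remLeft ℓ k i + remLength ℓ k) := by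
  induction k with
  | zero => exact ⟨0, by simp, by simpa [remLeft, remLength] using hx⟩
  | succ k ih =>
    obtain ⟨i, hi, hxi⟩ := ih
    by_cases h : x ≤ gapLeft ℓ k i
    · refine ⟨2 * i, by rw [pow_succ]; omega, ?_⟩
      rw [remLeft_two_mul]
      exact ⟨hxi.1, h⟩
    · refine ⟨2 * i + 1, by rw [pow_succ]; omega, ?_⟩
      rw [remLeft_two_mul_add_one, gapRight_add]
      refine ⟨?_, hxi.2⟩
      by_contra! h'
      exact hg ⟨k, i, hi, not_le.1 h, h'⟩

namespace IsCantorLength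

variable {ℓ : ℕ → ℝ} (H : IsCantorLength ℓ)
include H

theorem remLength_le (k : ℕ) : remLength ℓ k ≤ (1 / 2) ^ k := by
  induction k with
  | zero => simp [remLength]
  | succ k ih => rw [remLength_succ, pow_succ]; linarith [H.pos k]

theorem tendsto_remLength : Tendsto (remLength ℓ) atTop (𝓝 0) :=
  squeeze_zero (fun k => (H.rem_pos k).le) H.remLength_le
    (tendsto_pow_atTop_nhds_zero_of_lt_one (by norm_num) (by norm_num))

theorem remLeft_bounds (k : ℕ) : ∀ i < 2 ^ k,
    0 ≤ remLeft ℓ k i ∧ remLeft ℓ k i + remLength ℓ k ≤ 1 := by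
  induction k with
  | zero => intro i _; simp [remLeft, remLength]
  | succ k ih =>
    intro i hi
    have h := ih (i / 2) (by rw [pow_succ] at hi; omega)
    have e := remLength_succ ℓ k
    have h1 := H.pos k
    have h2 := H.rem_pos (k + 1)
    simp only [remLeft]
    split_ifs <;> constructor <;> linarith [h.1, h.2]

theorem remRight_lt (k : ℕ) : ∀ i j : ℕ, i < j → j < 2 ^ k →
    remLeft ℓ k i + remLength ℓ k < remLeft ℓ k j := by
  induction k with
  | zero => intro i j hij hj; simp at hj; omega
  | succ k ih =>
    intro i j hij hj
    have e := remLength_succ ℓ k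
    have h1 := H.pos k
    have h2 := H.rem_pos (k + 1)
    rcases (Nat.div_le_div_right hij.le : i / 2 ≤ j / 2).lt_or_eq with h | h
    · have := ih _ _ h (by rw [pow_succ] at hj; omega)
      simp only [remLeft]
      split_ifs <;> linarith
    · simp only [remLeft, h]
      rw [if_pos (by omega), if_neg (by omega)]
      linarith

theorem index_le {k i j : ℕ} (hi : i < 2 ^ k) (h : remLeft ℓ k i ≤ remLeft ℓ k j) :
    i ≤ j := by
  by_contra! hlt
  linarith [H.remRight_lt k j i hlt hi, H.rem_pos k]

theorem gapLeft_lt_gapRight (k i : ℕ) : gapLeft ℓ k i < gapRight ℓ k i := by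
  rw [gapRight]; linarith [H.pos k]

theorem remLeft_lt_gapLeft (k i : ℕ) : remLeft ℓ k i < gapLeft ℓ k i := by
  rw [gapLeft]; linarith [H.rem_pos (k + 1)]

theorem gapRight_lt (k i : ℕ) : gapRight ℓ k i < remLeft ℓ k i + remLength ℓ k := by
  linarith [gapRight_add ℓ k i, H.rem_pos (k + 1)]

theorem gap_subset {k i : ℕ} (hi : i < 2 ^ k) : gap ℓ k i ⊆ Ioo 0 1 := fun _ hx =>
  ⟨((H.remLeft_bounds k i hi).1.trans_lt (H.remLeft_lt_gapLeft k i)).trans hx.1,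
    hx.2.trans ((H.gapRight_lt k i).trans_le (H.remLeft_bounds k i hi).2)⟩

/-- Around a point off the gaps the remaining intervals shrink to the point. -/
theorem exists_seq {x : ℝ} (hx : x ∈ Ioo (0 : ℝ) 1 \ gapUnion ℓ) :
    ∃ i : ℕ → ℕ, (∀ k, i k < 2 ^ k) ∧ (∀ k, remLeft ℓ k (i k) ≤ x) ∧
      (∀ k, x ≤ remLeft ℓ k (i k) + remLength ℓ k) ∧
      Tendsto (fun k => remLeft ℓ k (i k)) atTop (𝓝 x) ∧
      Tendsto (fun k => remLeft ℓ k (i k) + remLength ℓ k) atTop (𝓝 x) := by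
  choose i hi hxi using exists_rem (Ioo_subset_Icc_self hx.1) hx.2
  have hl : Tendsto (fun k => x - remLength ℓ k) atTop (𝓝 x) := by
    simpa using H.tendsto_remLength.const_sub x
  have hr : Tendsto (fun k => x + remLength ℓ k) atTop (𝓝 x) := by
    simpa using H.tendsto_remLength.const_add x
  refine ⟨i, hi, fun k => (hxi k).1, fun k => (hxi k).2, ?_, ?_⟩
  · exact tendsto_of_tendsto_of_tendsto_of_le_of_le hl tendsto_const_nhds
      (fun k => by simpa using (hxi k).2) (fun k => (hxi k).1)
  · exact tendsto_of_tendsto_of_tendsto_of_le_of_le tendsto_const_nhds hr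
      (fun k => (hxi k).2) (fun k => by simpa using (hxi k).1)

/-- The remaining intervals around `x` shrink to `x`, and each contains the gap removed from it at
the next step. -/
theorem exists_gap_near {x : ℝ} (hx : x ∈ Ioo (0 : ℝ) 1 \ gapUnion ℓ) {ε : ℝ} (hε : 0 < ε) :
    ∃ k i : ℕ, i < 2 ^ k ∧ ∀ y ∈ gap ℓ k i, |y - x| < ε := by
  obtain ⟨i, hi, -, -, ha, hb⟩ := H.exists_seq hx
  obtain ⟨k, hk1, hk2⟩ := ((ha.eventually (Metric.ball_mem_nhds x hε)).and
    (hb.eventually (Metric.ball_mem_nhds x hε))).exists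
  refine ⟨k, i k, hi k, fun y hy => ?_⟩
  rw [Real.dist_eq, abs_lt] at hk1 hk2
  have h1 := H.remLeft_lt_gapLeft k (i k)
  have h2 := H.gapRight_lt k (i k)
  rw [abs_lt]
  constructor <;> linarith [hy.1, hy.2, hk1.1, hk2.2]

theorem gapMid_mem (k i : ℕ) : (gapLeft ℓ k i + gapRight ℓ k i) / 2 ∈ gap ℓ k i := by
  have := H.gapLeft_lt_gapRight k i
  constructor <;> linarith

theorem mem_closure_gapUnion {x : ℝ} (hx : x ∈ Ioo (0 : ℝ) 1) : x ∈ closure (gapUnion ℓ) := by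
  by_cases hg : x ∈ gapUnion ℓ
  · exact subset_closure hg
  · rw [Metric.mem_closure_iff]
    intro ε hε
    obtain ⟨k, i, hi, h⟩ := H.exists_gap_near ⟨hx, hg⟩ hε
    refine ⟨_, ⟨k, i, hi, H.gapMid_mem k i⟩, ?_⟩
    rw [dist_comm]
    exact h _ (H.gapMid_mem k i)

theorem gapwise_eventuallyEq (v : ℕ → ℕ → ℝ → ℝ) {x : ℝ} {k i : ℕ} (hi : i < 2 ^ k)
    (h : x ∈ gap ℓ k i) : gapwise ℓ v =ᶠ[𝓝 x] v k i := by
  filter_upwards [isOpen_Ioo.mem_nhds h] with y hy using gapwise_eq H.pos H.rem_pos v hi hy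

end IsCantorLength

/-! ### Measure -/

theorem hasSum_two_pow_div_three_pow (q : ℝ) :
    HasSum (fun k : ℕ => 2 ^ k * (q / 3 ^ (k + 1))) q := by
  have h := (hasSum_geometric_of_lt_one (r := (2 / 3 : ℝ)) (by norm_num) (by norm_num)).mul_left
    (q / 3)
  have e1 : (fun k : ℕ => 2 ^ k * (q / 3 ^ (k + 1))) = fun k : ℕ => q / 3 * (2 / 3 : ℝ) ^ k := by
    funext k; rw [div_pow, pow_succ]; field_simp
  have e2 : q / 3 * (1 - 2 / 3)⁻¹ = q := by ring
  rw [e2] at h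
  rwa [e1]

/-- If `D` were null, the sets `I k i` would cover almost all of `(0,1)` with total measure at most
`∑ 2 ^ k * q / 3 ^ (k + 1) = q < 1`. The sets are left general because for `f` they are images of
gaps. -/
theorem volume_pos_of_cover {D : Set ℝ} {I : ℕ → ℕ → Set ℝ} {q : ℝ} (hq0 : 0 ≤ q) (hq : q < 1)
    (hI : ∀ k i, i < 2 ^ k → volume (I k i) ≤ ENNReal.ofReal (q / 3 ^ (k + 1)))
    (hcov : ∀ x ∈ Ioo (0 : ℝ) 1, x ∈ D ∨ ∃ k i : ℕ, i < 2 ^ k ∧ x ∈ I k i) : 0 < volume D := by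
  rw [pos_iff_ne_zero]
  intro h0
  have hsub : Ioo (0 : ℝ) 1 ⊆ D ∪ ⋃ k, ⋃ i ∈ Finset.range (2 ^ k), I k i := by
    intro x hx
    rcases hcov x hx with h | ⟨k, i, hi, h⟩
    · exact Or.inl h
    · exact Or.inr (mem_iUnion.2 ⟨k, mem_iUnion₂.2 ⟨i, Finset.mem_range.2 hi, h⟩⟩)
  have h1 : volume (⋃ k, ⋃ i ∈ Finset.range (2 ^ k), I k i) ≤ ENNReal.ofReal q := by
    refine (measure_iUnion_le _).trans ?_
    rw [← (hasSum_two_pow_div_three_pow q).tsum_eq, ENNReal.ofReal_tsum_of_nonneg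
      (fun k => by positivity) (hasSum_two_pow_div_three_pow q).summable]
    refine ENNReal.tsum_le_tsum fun k => (measure_biUnion_finset_le _ _).trans ?_
    refine (Finset.sum_le_sum fun i hi => hI k i (Finset.mem_range.1 hi)).trans ?_
    rw [Finset.sum_const, Finset.card_range, nsmul_eq_mul, ENNReal.ofReal_mul (by positivity)]
    gcongr
    rw [ENNReal.ofReal_pow (by norm_num)]
    simp
  have h2 : volume (Ioo (0 : ℝ) 1) ≤ ENNReal.ofReal q :=
    (measure_mono hsub).trans ((measure_union_le _ _).trans (by rw [h0, zero_add]; exact h1))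
  rw [Real.volume_Ioo, ENNReal.ofReal_le_ofReal_iff hq0] at h2
  linarith

theorem volume_pos_of_notMem_gapUnion {ℓ : ℕ → ℝ} {D : Set ℝ} {q : ℝ} (hq0 : 0 ≤ q) (hq : q < 1)
    (hℓ : ∀ k, ℓ (k + 1) ≤ q / 3 ^ (k + 1)) (hD : Ioo (0 : ℝ) 1 \ gapUnion ℓ ⊆ D) :
    0 < volume D := by
  refine volume_pos_of_cover (I := gap ℓ) hq0 hq (fun k i _ => ?_) fun x hx => ?_
  · rw [gap, Real.volume_Ioo]
    refine ENNReal.ofReal_le_ofReal ?_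
    rw [gapRight]; linarith [hℓ k]
  · by_cases h : x ∈ gapUnion ℓ
    · exact Or.inr h
    · exact Or.inl (hD ⟨hx, h⟩)

/-! ### The lengths considered -/

theorem remLength_cantorLen (lam : ℝ) (k : ℕ) :
    remLength (cantorLen lam) k = (1 - lam + lam * (2 / 3) ^ k) / 2 ^ k := by
  induction k with
  | zero => simp [remLength]
  | succ k ih =>
    rw [remLength_succ, ih, cantorLen, div_pow, div_pow]
    field_simp
    ring

theorem remLength_anti {ℓ ℓ' : ℕ → ℝ} (h : ∀ k, ℓ (k + 1) ≤ ℓ' (k + 1)) (k : ℕ) :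
    remLength ℓ' k ≤ remLength ℓ k := by
  induction k with
  | zero => exact le_rfl
  | succ k ih => rw [remLength_succ, remLength_succ]; linarith [h k]

/-- Removing less leaves longer intervals, so positivity is inherited from the classical Cantor set.
-/
theorem isCantorLength_of_le {ℓ : ℕ → ℝ} (h0 : ∀ k, 0 < ℓ (k + 1))
    (h : ∀ k, ℓ (k + 1) ≤ 1 / 3 ^ (k + 1)) : IsCantorLength ℓ := by
  refine ⟨h0, fun k => lt_of_lt_of_le ?_ (remLength_anti (ℓ' := cantorLen 1) h k)⟩
  rw [remLength_cantorLen]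
  simp only [sub_self, zero_add]
  positivity

theorem isCantorLength_cantorLen {lam : ℝ} (h : lam ∈ Ioc (0 : ℝ) 1) :
    IsCantorLength (cantorLen lam) :=
  isCantorLength_of_le (fun k => div_pos h.1 (by positivity)) fun k => by
    rw [cantorLen]; gcongr; exact h.2

/-- The constant `3 / 4` is sharp at `k = 0`. The true total removed is `1 / 2`, but any bound below
1 serves. -/
theorem svcLen_le (k : ℕ) : svcLen (k + 1) ≤ (3 / 4) / 3 ^ (k + 1) := by
  rw [svcLen, div_div, div_le_div_iff₀ (by positivity) (by positivity), pow_succ, pow_succ]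
  have : (3 : ℝ) ^ k ≤ 4 ^ k := by gcongr; norm_num
  linarith

theorem isCantorLength_svcLen : IsCantorLength svcLen :=
  isCantorLength_of_le (fun k => by rw [svcLen]; positivity) fun k => (svcLen_le k).trans (by
    gcongr; norm_num)

/-- After step `k` the complement is covered by `2 ^ k` intervals of length `1 / 3 ^ k`. -/
theorem ae_mem_gapUnion_cantorLen_one :
    ∀ᵐ x ∂(volume.restrict (Ioo (0 : ℝ) 1)), x ∈ gapUnion (cantorLen 1) := by
  rw [ae_restrict_iff' measurableSet_Ioo, ae_iff]
  refine le_antisymm ?_ zero_le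
  have hlim : Tendsto (fun k : ℕ => ENNReal.ofReal ((2 / 3) ^ k)) atTop (𝓝 0) := by
    rw [← ENNReal.ofReal_zero]
    exact ENNReal.tendsto_ofReal
      (tendsto_pow_atTop_nhds_zero_of_lt_one (by norm_num) (by norm_num))
  refine ge_of_tendsto' hlim fun k => ?_
  have hsub : {x | ¬ (x ∈ Ioo (0 : ℝ) 1 → x ∈ gapUnion (cantorLen 1))} ⊆
      ⋃ i ∈ Finset.range (2 ^ k), Icc (remLeft (cantorLen 1) k i)
        (remLeft (cantorLen 1) k i + remLength (cantorLen 1) k) := by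
    intro x hx
    obtain ⟨h1, h2⟩ := Classical.not_imp.1 hx
    obtain ⟨i, hi, hxi⟩ := exists_rem (Ioo_subset_Icc_self h1) h2 k
    exact mem_iUnion₂.2 ⟨i, Finset.mem_range.2 hi, hxi⟩
  refine (measure_mono hsub).trans ((measure_biUnion_finset_le _ _).trans (le_of_eq ?_))
  simp only [Real.volume_Icc, add_sub_cancel_left, Finset.sum_const, Finset.card_range,
    nsmul_eq_mul]
  rw [remLength_cantorLen, ← ENNReal.ofReal_natCast, ← ENNReal.ofReal_mul (by positivity)]
  congr 1
  push_cast
  field_simp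
  ring

/-! ## The Cantor function of a Cantor-type construction -/

/-- The monotone function mapping the `i`-th interval that remains after step `k` onto
`[i / 2 ^ k, (i + 1) / 2 ^ k]`. -/
noncomputable def stairs (ℓ : ℕ → ℝ) (x : ℝ) : ℝ :=
  sSup {t | ∃ k i : ℕ, i < 2 ^ k ∧ remLeft ℓ k i ≤ x ∧ t = (i : ℝ) / 2 ^ k}

theorem dyadic_le_one {k i : ℕ} (hi : i < 2 ^ k) : (i : ℝ) / 2 ^ k ≤ 1 := by
  rw [div_le_one (by positivity)]
  exact_mod_cast hi.le

theorem bddAbove_stairs (ℓ : ℕ → ℝ) (x : ℝ) :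
    BddAbove {t | ∃ k i : ℕ, i < 2 ^ k ∧ remLeft ℓ k i ≤ x ∧ t = (i : ℝ) / 2 ^ k} := by
  refine ⟨1, ?_⟩
  rintro _ ⟨k, i, hi, -, rfl⟩
  exact dyadic_le_one hi

theorem le_stairs {ℓ : ℕ → ℝ} {x : ℝ} {k i : ℕ} (hi : i < 2 ^ k) (h : remLeft ℓ k i ≤ x) :
    (i : ℝ) / 2 ^ k ≤ stairs ℓ x :=
  le_csSup (bddAbove_stairs ℓ x) ⟨k, i, hi, h, rfl⟩

theorem stairs_nonneg (ℓ : ℕ → ℝ) (x : ℝ) : 0 ≤ stairs ℓ x := by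
  refine Real.sSup_nonneg ?_
  rintro _ ⟨k, i, -, -, rfl⟩
  positivity

theorem stairs_le_one (ℓ : ℕ → ℝ) (x : ℝ) : stairs ℓ x ≤ 1 := by
  refine Real.sSup_le ?_ zero_le_one
  rintro _ ⟨k, i, hi, -, rfl⟩
  exact dyadic_le_one hi

theorem stairs_monotone (ℓ : ℕ → ℝ) : Monotone (stairs ℓ) := by
  intro x y hxy
  refine Real.sSup_le ?_ (stairs_nonneg ℓ y)
  rintro _ ⟨k, i, hi, h, rfl⟩
  exact le_stairs hi (h.trans hxy)

namespace IsCantorLength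

variable {ℓ : ℕ → ℝ} (H : IsCantorLength ℓ)
include H

/-- Both indices are refined to step `m + k`, where the order of left endpoints is the order of
indices. -/
theorem stairs_le {x : ℝ} {k j : ℕ} (hx : x ≤ remLeft ℓ k j) :
    stairs ℓ x ≤ (j : ℝ) / 2 ^ k := by
  refine Real.sSup_le ?_ (by positivity)
  rintro _ ⟨m, i, hi, h, rfl⟩
  have h' := h.trans hx
  rw [← remLeft_mul_two_pow ℓ m i k, ← remLeft_mul_two_pow ℓ k j m, add_comm k m] at h'
  have hle := H.index_le (by rw [pow_add]; gcongr) h'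
  rw [div_le_div_iff₀ (by positivity) (by positivity)]
  exact_mod_cast hle

theorem stairs_remLeft {k i : ℕ} (hi : i < 2 ^ k) :
    stairs ℓ (remLeft ℓ k i) = (i : ℝ) / 2 ^ k :=
  le_antisymm (H.stairs_le le_rfl) (le_stairs hi le_rfl)

theorem stairs_remRight {k i : ℕ} (hi : i < 2 ^ k) :
    stairs ℓ (remLeft ℓ k i + remLength ℓ k) = ((i : ℝ) + 1) / 2 ^ k := by
  apply le_antisymm
  · rcases (Nat.succ_le_of_lt hi).lt_or_eq with h | h
    · have := H.stairs_le (H.remRight_lt k i (i + 1) (Nat.lt_succ_self i) h).le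
      exact_mod_cast this
    · have : ((i : ℝ) + 1) / 2 ^ k = 1 := by
        rw [div_eq_one_iff_eq (by positivity)]
        exact_mod_cast h
      rw [this]
      exact stairs_le_one _ _
  -- The left endpoints of the rightmost descendants lie below the right endpoint, and their dyadic
  -- values increase to `(i + 1) / 2 ^ k`.
  · have hlim : Tendsto (fun m : ℕ => ((i : ℝ) + 1) / 2 ^ k - 1 / 2 ^ k * (1 / 2) ^ m) atTop
        (𝓝 (((i : ℝ) + 1) / 2 ^ k)) := by
      have := (tendsto_pow_atTop_nhds_zero_of_lt_one (r := (1 / 2 : ℝ)) (by norm_num)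
        (by norm_num)).const_mul (1 / 2 ^ k : ℝ)
      simpa using this.const_sub (((i : ℝ) + 1) / 2 ^ k)
    refine le_of_tendsto' hlim fun m => ?_
    have hpos : 0 < (i + 1) * 2 ^ m := by positivity
    have hlt : (i + 1) * 2 ^ m - 1 < 2 ^ (k + m) := by
      have : (i + 1) * 2 ^ m ≤ 2 ^ k * 2 ^ m := by gcongr; exact hi
      rw [pow_add]; omega
    have h := le_stairs (ℓ := ℓ) hlt ((le_add_of_nonneg_right (H.rem_pos (k + m)).le).trans
      (remRight_last ℓ k i m).le)
    refine le_trans (le_of_eq ?_) h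
    rw [Nat.cast_sub hpos]
    push_cast
    rw [pow_add, div_pow, one_pow]
    field_simp

/-- The gap lies between the children `2 * i` and `2 * i + 1`; `stairs` has the same value at its
two ends and is monotone. -/
theorem stairs_gap {x : ℝ} {k i : ℕ} (hi : i < 2 ^ k)
    (hx : x ∈ Icc (gapLeft ℓ k i) (gapRight ℓ k i)) :
    stairs ℓ x = (2 * (i : ℝ) + 1) / 2 ^ (k + 1) := by
  have h1 := H.stairs_remRight (k := k + 1) (i := 2 * i) (by rw [pow_succ]; omega)
  have h2 := H.stairs_remLeft (k := k + 1) (i := 2 * i + 1) (by rw [pow_succ]; omega)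
  rw [remLeft_two_mul] at h1
  rw [remLeft_two_mul_add_one] at h2
  push_cast at h1 h2
  exact le_antisymm ((stairs_monotone ℓ hx.2).trans h2.le) (h1.ge.trans (stairs_monotone ℓ hx.1))

/-- Once the remaining intervals are shorter than `x` and `1 - x`, the point lies beyond the left
end of the second interval of the next step and before that of the last interval. -/
theorem stairs_mem_Ioo {x : ℝ} (hx : x ∈ Ioo (0 : ℝ) 1) : stairs ℓ x ∈ Ioo (0 : ℝ) 1 := by
  obtain ⟨k, hk1, hk2⟩ := ((H.tendsto_remLength.eventually (gt_mem_nhds hx.1)).and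
    (H.tendsto_remLength.eventually (gt_mem_nhds (sub_pos.2 hx.2)))).exists
  have hk : 1 < 2 ^ (k + 1) := Nat.one_lt_two_pow (by omega)
  constructor
  · refine lt_of_lt_of_le ?_ (le_stairs hk (x := x) (ℓ := ℓ) ?_)
    · positivity
    · have h := remLeft_two_mul_add_one ℓ k 0
      have h2 := H.gapRight_lt k 0
      have h3 := remLeft_mul_two_pow ℓ 0 0 k
      rw [zero_mul, zero_add] at h3
      simp only [mul_zero, zero_add] at h
      rw [h]
      rw [h3] at h2
      simp only [remLeft] at h2
      linarith
  · have hr := remRight_last ℓ 0 0 k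
    simp only [remLeft, remLength, zero_add, one_mul] at hr
    have hle : x ≤ remLeft ℓ k (2 ^ k - 1) := by linarith
    refine (H.stairs_le hle).trans_lt ?_
    rw [div_lt_one (by positivity)]
    have : 2 ^ k - 1 < 2 ^ k := Nat.sub_lt (by positivity) one_pos
    exact_mod_cast this

/-- A monotone function whose values are dense around `stairs ℓ x` cannot jump there; all dyadics in
`[0,1)` are values, and rounding down gives one close to any `t`. -/
theorem continuousAt_stairs {x : ℝ} (hx : x ∈ Ioo (0 : ℝ) 1) : ContinuousAt (stairs ℓ) x := by
  refine continuousAt_of_monotoneOn_of_closure_image_mem_nhds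
    ((stairs_monotone ℓ).monotoneOn _) univ_mem ?_
  refine mem_of_superset (isOpen_Ioo.mem_nhds (H.stairs_mem_Ioo hx)) fun t ht => ?_
  rw [Metric.mem_closure_iff]
  intro ε hε
  obtain ⟨k, hk⟩ := exists_pow_lt_of_lt_one hε (show (1 / 2 : ℝ) < 1 by norm_num)
  have h2 : (0 : ℝ) < 2 ^ k := by positivity
  have hf := Nat.floor_le (mul_nonneg ht.1.le h2.le)
  have hf' := Nat.lt_floor_add_one (t * 2 ^ k)
  have hi : ⌊t * 2 ^ k⌋₊ < 2 ^ k := by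
    rw [Nat.floor_lt (mul_nonneg ht.1.le h2.le)]
    push_cast
    nlinarith [ht.2]
  refine ⟨_, ⟨_, mem_univ _, H.stairs_remLeft hi⟩, ?_⟩
  refine lt_of_le_of_lt ?_ hk
  rw [Real.dist_eq, abs_of_nonneg, sub_le_iff_le_add, div_pow, one_pow, ← add_div,
    le_div_iff₀ h2]
  · linarith
  · rwa [sub_nonneg, div_le_iff₀ h2]

theorem extendFrom_gapwise {x : ℝ} (hx : x ∈ Ioo (0 : ℝ) 1) :
    extendFrom (gapUnion ℓ) (gapwise ℓ fun k i _ => (2 * (i : ℝ) + 1) / 2 ^ (k + 1)) x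
      = stairs ℓ x := by
  refine extendFrom_eq (H.mem_closure_gapUnion hx) ?_
  refine ((H.continuousAt_stairs hx).continuousWithinAt (s := gapUnion ℓ)).congr' ?_
  filter_upwards [self_mem_nhdsWithin] with y hy
  obtain ⟨k, i, hi, h⟩ := exists_gap_of_mem_gapUnion hy
  rw [gapwise_eq H.pos H.rem_pos _ hi h, H.stairs_gap hi (Ioo_subset_Icc_self h)]

theorem hasDerivAt_stairs_gap {x : ℝ} {k i : ℕ} (hi : i < 2 ^ k) (hx : x ∈ gap ℓ k i) :
    HasDerivAt (stairs ℓ) 0 x := by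
  refine (hasDerivAt_const x ((2 * (i : ℝ) + 1) / 2 ^ (k + 1))).congr_of_eventuallyEq ?_
  filter_upwards [isOpen_Ioo.mem_nhds hx] with y hy
    using H.stairs_gap hi (Ioo_subset_Icc_self hy)

/-- Across each remaining interval of step `k` the function rises by exactly `1 / 2 ^ k`. -/
theorem tendsto_stairs_slope {x : ℝ} (hx : x ∈ Ioo (0 : ℝ) 1 \ gapUnion ℓ)
    (hd : DifferentiableAt ℝ (stairs ℓ) x) :
    Tendsto (fun k => 1 / 2 ^ k / remLength ℓ k) atTop (𝓝 (deriv (stairs ℓ) x)) := by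
  obtain ⟨i, hi, hax, hxb, ha, hb⟩ := H.exists_seq hx
  refine (hd.hasDerivAt.tendsto_straddle ha hb hax hxb
    fun k => lt_add_of_pos_right _ (H.rem_pos k)).congr fun k => ?_
  rw [H.stairs_remRight (hi k), H.stairs_remLeft (hi k), add_sub_cancel_left, ← sub_div,
    add_sub_cancel_left]

end IsCantorLength

theorem cantorFunction_eq {lam : ℝ} (h : lam ∈ Ioc (0 : ℝ) 1) {x : ℝ} (hx : x ∈ Ioo (0 : ℝ) 1) :
    cantorFunction lam x = stairs (cantorLen lam) x :=
  (isCantorLength_cantorLen h).extendFrom_gapwise hx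

theorem cantorFunction_eventuallyEq {lam : ℝ} (h : lam ∈ Ioc (0 : ℝ) 1) {x : ℝ}
    (hx : x ∈ Ioo (0 : ℝ) 1) : cantorFunction lam =ᶠ[𝓝 x] stairs (cantorLen lam) := by
  filter_upwards [isOpen_Ioo.mem_nhds hx] with y hy using cantorFunction_eq h hy

theorem continuousOn_cantorFunction {lam : ℝ} (h : lam ∈ Ioc (0 : ℝ) 1) :
    ContinuousOn (cantorFunction lam) (Ioo 0 1) := fun _ hx =>
  (((isCantorLength_cantorLen h).continuousAt_stairs hx).congr
    (cantorFunction_eventuallyEq h hx).symm).continuousWithinAt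

theorem aeDifferentiableOn_of_monotoneOn {f : ℝ → ℝ} {X : Set ℝ} (hX : IsOpen X)
    (hf : MonotoneOn f X) : AEDifferentiableOn X f := by
  rw [AEDifferentiableOn, ae_restrict_iff' hX.measurableSet]
  filter_upwards [hf.ae_differentiableWithinAt_of_mem] with x hx hxX
    using (hx hxX).differentiableAt (hX.mem_nhds hxX)

theorem aeDifferentiableOn_cantorFunction {lam : ℝ} (h : lam ∈ Ioc (0 : ℝ) 1) :
    AEDifferentiableOn (Ioo 0 1) (cantorFunction lam) := by
  refine aeDifferentiableOn_of_monotoneOn isOpen_Ioo fun x hx y hy hxy => ?_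
  rw [cantorFunction_eq h hx, cantorFunction_eq h hy]
  exact stairs_monotone _ hxy

theorem volume_derivDefectSet_cantorFunction_pos {lam : ℝ} (h : lam ∈ Ioo (0 : ℝ) 1) :
    0 < volume (derivDefectSet (Ioo 0 1) (cantorFunction lam)) := by
  have h' := Ioo_subset_Ioc_self h
  have H := isCantorLength_cantorLen h'
  refine volume_pos_of_notMem_gapUnion (ℓ := cantorLen lam) h.1.le h.2 (fun _ => le_rfl)
    fun x hx => ?_
  refine mem_derivDefectSet_of_frequently (c := 0) hx.1 (fun hd => ?_) fun ε hε => ?_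
  · have he := cantorFunction_eventuallyEq h' hx.1
    rw [he.deriv_eq]
    rw [he.differentiableAt_iff] at hd
    -- Since `remLength ≤ (1 / 2) ^ k`, all these slopes are at least 1, and so is their limit.
    refine ne_of_gt (zero_lt_one.trans_le (ge_of_tendsto' (H.tendsto_stairs_slope hx hd) ?_))
    intro k
    rw [le_div_iff₀ (H.rem_pos k), one_mul]
    simpa using H.remLength_le k
  · obtain ⟨k, i, hi, hk⟩ := H.exists_gap_near hx hε
    have hm := H.gapMid_mem k i
    refine ⟨_, H.gap_subset hi hm, hk _ hm, ?_⟩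
    exact (H.hasDerivAt_stairs_gap hi hm).congr_of_eventuallyEq
      (cantorFunction_eventuallyEq h' (H.gap_subset hi hm))

/-! ### The classical Cantor set -/

theorem remLength_cantorLen_one (k : ℕ) : remLength (cantorLen 1) k = 1 / 3 ^ k := by
  rw [remLength_cantorLen, div_pow]
  field_simp
  ring

theorem isCantorLength_cantorLen_one : IsCantorLength (cantorLen 1) :=
  isCantorLength_cantorLen (by simp)

theorem tendsto_three_halves_pow_atTop :
    Tendsto (fun k : ℕ => (3 / 2 : ℝ) ^ k) atTop atTop :=
  tendsto_pow_atTop_atTop_of_one_lt (by norm_num)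

theorem not_differentiableAt_cantorFunction_one {x : ℝ}
    (hx : x ∈ Ioo (0 : ℝ) 1 \ gapUnion (cantorLen 1)) :
    ¬ DifferentiableAt ℝ (cantorFunction 1) x := by
  intro hd
  rw [(cantorFunction_eventuallyEq (by simp) hx.1).differentiableAt_iff] at hd
  refine not_tendsto_nhds_of_tendsto_atTop tendsto_three_halves_pow_atTop _
    ((isCantorLength_cantorLen_one.tendsto_stairs_slope hx hd).congr fun k => ?_)
  rw [remLength_cantorLen_one, div_pow]
  field_simp

/-- The gaps contribute only countably many values of `stairs`, yet its image is connected and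
contains `[1/4, 1/2]`; the two ends are its values on the first gaps of steps 2 and 1. -/
theorem not_countable_cantorSet_one :
    ¬ (Ioo (0 : ℝ) 1 \ gapUnion (cantorLen 1)).Countable := by
  intro hc
  have H := isCantorLength_cantorLen_one
  have himg : (stairs (cantorLen 1) '' Ioo (0 : ℝ) 1).Countable := by
    refine ((hc.image (stairs (cantorLen 1))).union
      (countable_range fun p : ℕ × ℕ => (2 * (p.2 : ℝ) + 1) / 2 ^ (p.1 + 1))).mono ?_
    rintro _ ⟨x, hx, rfl⟩
    by_cases hg : x ∈ gapUnion (cantorLen 1)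
    · obtain ⟨k, i, hi, h⟩ := exists_gap_of_mem_gapUnion hg
      exact Or.inr ⟨(k, i), (H.stairs_gap hi (Ioo_subset_Icc_self h)).symm⟩
    · exact Or.inl ⟨x, ⟨hx, hg⟩, rfl⟩
  have hpc : IsPreconnected (stairs (cantorLen 1) '' Ioo (0 : ℝ) 1) :=
    isPreconnected_Ioo.image _ fun x hx => (H.continuousAt_stairs hx).continuousWithinAt
  have h0 := H.gapMid_mem 0 0
  have h1 := H.gapMid_mem 1 0
  have hm0 : (1 / 2 : ℝ) ∈ stairs (cantorLen 1) '' Ioo (0 : ℝ) 1 :=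
    ⟨_, H.gap_subset (by norm_num) h0, by
      rw [H.stairs_gap (by norm_num) (Ioo_subset_Icc_self h0)]; norm_num⟩
  have hm1 : (1 / 4 : ℝ) ∈ stairs (cantorLen 1) '' Ioo (0 : ℝ) 1 :=
    ⟨_, H.gap_subset (by norm_num) h1, by
      rw [H.stairs_gap (by norm_num) (Ioo_subset_Icc_self h1)]; norm_num⟩
  have hI := himg.mono (hpc.Icc_subset hm1 hm0)
  have hz := hI.measure_zero volume
  rw [Real.volume_Icc] at hz
  norm_num at hz

/-! ## The inverse of the average of the Cantor function and the identity -/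

/-- The average of the `1`-Cantor function and the identity. -/
noncomputable def stairsMean (x : ℝ) : ℝ := (stairs (cantorLen 1) x + x) / 2

theorem stairsMean_strictMono : StrictMono stairsMean := fun x y hxy => by
  have := stairs_monotone (cantorLen 1) hxy.le
  rw [stairsMean, stairsMean]; linarith

theorem stairsMean_mem_Ioo {x : ℝ} (hx : x ∈ Ioo (0 : ℝ) 1) : stairsMean x ∈ Ioo (0 : ℝ) 1 := by
  have h := isCantorLength_cantorLen_one.stairs_mem_Ioo hx
  rw [stairsMean]
  constructor <;> linarith [h.1, h.2, hx.1, hx.2]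

theorem continuousAt_stairsMean {x : ℝ} (hx : x ∈ Ioo (0 : ℝ) 1) :
    ContinuousAt stairsMean x :=
  ((isCantorLength_cantorLen_one.continuousAt_stairs hx).add continuousAt_id).div_const 2

/-- Continuity of `stairs` is available only inside `(0,1)`, so the intermediate value theorem is
applied between the right end of the first remaining interval, where the mean is at most `(1 / 2) ^
k`, and the left end of the last, where it is at least `1 - (1 / 2) ^ k`. -/
theorem surjOn_stairsMean : SurjOn stairsMean (Ioo 0 1) (Ioo 0 1) := by
  intro y hy
  have H := isCantorLength_cantorLen_one
  obtain ⟨k, hk⟩ := exists_pow_lt_of_lt_one (lt_min hy.1 (sub_pos.2 hy.2))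
    (show (1 / 2 : ℝ) < 1 by norm_num)
  have hk1 := hk.trans_le (min_le_left _ _)
  have hk2 := hk.trans_le (min_le_right _ _)
  have hle := H.remLength_le k
  have hpos := H.rem_pos k
  have hl := remLeft_mul_two_pow (cantorLen 1) 0 0 k
  have hr := remRight_last (cantorLen 1) 0 0 k
  have h2 : (0 : ℝ) < 2 ^ k := by positivity
  have e2 : (1 : ℝ) / 2 ^ k = (1 / 2) ^ k := by rw [div_pow, one_pow]
  simp only [zero_mul, zero_add, one_mul, remLeft, remLength] at hl hr
  have hs1 := H.stairs_remRight (k := k) (i := 0) (by positivity)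
  have hs2 := H.stairs_remLeft (k := k) (i := 2 ^ k - 1) (Nat.sub_lt (by positivity) one_pos)
  rw [hl, zero_add, Nat.cast_zero, zero_add, e2] at hs1
  rw [Nat.cast_sub Nat.one_le_two_pow] at hs2
  push_cast at hs2
  rw [sub_div, div_self h2.ne', e2] at hs2
  have hp : remLength (cantorLen 1) k ∈ Ioo (0 : ℝ) 1 := ⟨hpos, by linarith [hy.2]⟩
  have hq : remLeft (cantorLen 1) k (2 ^ k - 1) ∈ Ioo (0 : ℝ) 1 :=
    ⟨by linarith [hy.1], by linarith⟩
  refine isPreconnected_Ioo.intermediate_value hp hq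
    (fun x hx => (continuousAt_stairsMean hx).continuousWithinAt) ⟨?_, ?_⟩
  · rw [stairsMean, hs1]; linarith
  · rw [stairsMean, hs2]; linarith

theorem fClaim1_spec {y : ℝ} (hy : y ∈ Ioo (0 : ℝ) 1) :
    fClaim1 y ∈ Ioo (0 : ℝ) 1 ∧ stairsMean (fClaim1 y) = y := by
  have he : ∀ x ∈ Ioo (0 : ℝ) 1, (cantorFunction 1 x + x) / 2 = stairsMean x := fun x hx => by
    rw [cantorFunction_eq (by simp) hx, stairsMean]
  obtain ⟨x, hx, hxy⟩ := surjOn_stairsMean hy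
  have h := Function.invFunOn_pos (f := fun x => (cantorFunction 1 x + x) / 2)
    ⟨x, hx, (he x hx).trans hxy⟩
  exact ⟨h.1, (he _ h.1).symm.trans h.2⟩

theorem fClaim1_stairsMean {x : ℝ} (hx : x ∈ Ioo (0 : ℝ) 1) : fClaim1 (stairsMean x) = x :=
  stairsMean_strictMono.injective (fClaim1_spec (stairsMean_mem_Ioo hx)).2

theorem strictMonoOn_fClaim1 : StrictMonoOn fClaim1 (Ioo 0 1) := fun y hy z hz hyz => by
  rw [← (fClaim1_spec hy).2, ← (fClaim1_spec hz).2] at hyz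
  exact stairsMean_strictMono.lt_iff_lt.1 hyz

theorem continuousOn_fClaim1 : ContinuousOn fClaim1 (Ioo 0 1) := fun y hy => by
  refine (continuousAt_of_monotoneOn_of_image_mem_nhds strictMonoOn_fClaim1.monotoneOn
    (isOpen_Ioo.mem_nhds hy) ?_).continuousWithinAt
  refine mem_of_superset (isOpen_Ioo.mem_nhds (fClaim1_spec hy).1) fun x hx => ?_
  exact ⟨_, stairsMean_mem_Ioo hx, fClaim1_stairsMean hx⟩

/-- Straddle `y` by the images of the ends of the remaining intervals: `f` rises by `3⁻ᵏ` over a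
length `(2⁻ᵏ + 3⁻ᵏ) / 2`, a slope tending to 0. -/
theorem deriv_fClaim1_eq_zero {y : ℝ} (hy : y ∈ Ioo (0 : ℝ) 1)
    (hg : fClaim1 y ∉ gapUnion (cantorLen 1)) (hd : DifferentiableAt ℝ fClaim1 y) :
    deriv fClaim1 y = 0 := by
  have H := isCantorLength_cantorLen_one
  obtain ⟨hx, hxy⟩ := fClaim1_spec hy
  obtain ⟨i, hi, hax, hxb, ha, hb⟩ := H.exists_seq ⟨hx, hg⟩
  -- The ends lie in `(0,1)`, where `f` inverts the mean, only from some step on; hence the shift by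
  -- `N`.
  obtain ⟨N, hN⟩ := eventually_atTop.1 ((ha.eventually (isOpen_Ioo.mem_nhds hx)).and
    (hb.eventually (isOpen_Ioo.mem_nhds hx)))
  have hcont := continuousAt_stairsMean hx
  rw [ContinuousAt, hxy] at hcont
  have hab : ∀ k, remLeft (cantorLen 1) k (i k)
      < remLeft (cantorLen 1) k (i k) + remLength (cantorLen 1) k :=
    fun k => lt_add_of_pos_right _ (H.rem_pos k)
  have hshift : Tendsto (fun n => n + N) atTop atTop := tendsto_add_atTop_nat N
  refine tendsto_nhds_unique (hd.hasDerivAt.tendsto_straddle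
    (hcont.comp (ha.comp hshift)) (hcont.comp (hb.comp hshift))
    (fun n => (stairsMean_strictMono.monotone (hax _)).trans hxy.le)
    (fun n => hxy.ge.trans (stairsMean_strictMono.monotone (hxb _)))
    (fun n => stairsMean_strictMono (hab _))) ?_
  have hlim : Tendsto (fun k : ℕ => 2 / ((3 / 2 : ℝ) ^ k + 1)) atTop (𝓝 0) :=
    tendsto_const_nhds.div_atTop (tendsto_atTop_add_const_right _ 1 tendsto_three_halves_pow_atTop)
  refine (hlim.comp hshift).congr fun n => ?_
  obtain ⟨h1, h2⟩ := hN (n + N) (Nat.le_add_left N n)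
  simp only [Function.comp_apply]
  rw [fClaim1_stairsMean h1, fClaim1_stairsMean h2, stairsMean, stairsMean,
    H.stairs_remRight (hi _), H.stairs_remLeft (hi _), remLength_cantorLen_one, div_pow,
    add_sub_cancel_left]
  have h2 : (0 : ℝ) < 2 ^ (n + N) := by positivity
  have h3 : (0 : ℝ) < 3 ^ (n + N) := by positivity
  generalize (2 : ℝ) ^ (n + N) = p at h2 ⊢
  generalize (3 : ℝ) ^ (n + N) = q at h3 ⊢
  rw [show ∀ u a : ℝ, ((u + 1) / p + (a + 1 / q)) / 2 - (u / p + a) / 2 = (1 / p + 1 / q) / 2 from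
    fun u a => by ring]
  field_simp

/-- On a gap the mean is `z ↦ (v + z) / 2`, with inverse `z ↦ 2 * z - v`. -/
theorem hasDerivAt_fClaim1_gap {x : ℝ} {k i : ℕ} (hi : i < 2 ^ k)
    (hx : x ∈ gap (cantorLen 1) k i) : HasDerivAt fClaim1 2 (stairsMean x) := by
  have H := isCantorLength_cantorLen_one
  set v : ℝ := (2 * (i : ℝ) + 1) / 2 ^ (k + 1)
  have hs : ∀ z ∈ gap (cantorLen 1) k i, stairsMean z = (v + z) / 2 := fun z hz => by
    rw [stairsMean, H.stairs_gap hi (Ioo_subset_Icc_self hz)]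
  have hlin : HasDerivAt (fun z : ℝ => 2 * z - v) 2 (stairsMean x) := by
    simpa using ((hasDerivAt_id (stairsMean x)).const_mul 2).sub_const v
  refine hlin.congr_of_eventuallyEq ?_
  have hmem : 2 * stairsMean x - v ∈ gap (cantorLen 1) k i := by
    rw [hs x hx]; convert hx using 1; ring
  filter_upwards [hlin.continuousAt.eventually (isOpen_Ioo.mem_nhds hmem)] with z hz
  have hz' : stairsMean (2 * z - v) = z := by rw [hs _ hz]; ring
  rw [← fClaim1_stairsMean (H.gap_subset hi hz), hz']

theorem volume_derivDefectSet_fClaim1_pos :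
    0 < volume (derivDefectSet (Ioo 0 1) fClaim1) := by
  have H := isCantorLength_cantorLen_one
  -- The mean halves the length of every gap, because `stairs` is constant there.
  refine volume_pos_of_cover (q := 1 / 2)
    (I := fun k i => Icc (stairsMean (gapLeft (cantorLen 1) k i))
      (stairsMean (gapRight (cantorLen 1) k i)))
    (by norm_num) (by norm_num) (fun k i hi => ?_) fun y hy => ?_
  · have hlr := (H.gapLeft_lt_gapRight k i).le
    rw [Real.volume_Icc, stairsMean, stairsMean, H.stairs_gap hi (left_mem_Icc.2 hlr),
      H.stairs_gap hi (right_mem_Icc.2 hlr), gapRight, cantorLen]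
    refine ENNReal.ofReal_le_ofReal (le_of_eq ?_)
    ring
  obtain ⟨hx, hxy⟩ := fClaim1_spec hy
  by_cases hg : fClaim1 y ∈ gapUnion (cantorLen 1)
  · obtain ⟨k, i, hi, h⟩ := exists_gap_of_mem_gapUnion hg
    refine Or.inr ⟨k, i, hi, ?_⟩
    rw [← hxy]
    exact ⟨stairsMean_strictMono.monotone h.1.le, stairsMean_strictMono.monotone h.2.le⟩
  · refine Or.inl (mem_derivDefectSet_of_frequently (c := 2) hy (fun hd => ?_) fun ε hε => ?_)
    · rw [deriv_fClaim1_eq_zero hy hg hd]; norm_num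
    · obtain ⟨δ, hδ, hδ'⟩ := Metric.continuousAt_iff.1 (continuousAt_stairsMean hx) ε hε
      obtain ⟨k, i, hi, hk⟩ := H.exists_gap_near ⟨hx, hg⟩ hδ
      have hm := H.gapMid_mem k i
      refine ⟨_, stairsMean_mem_Ioo (H.gap_subset hi hm), ?_, hasDerivAt_fClaim1_gap hi hm⟩
      have := hδ' (hk _ hm)
      rwa [hxy] at this

/-! ## Parabolas over the gaps of the classical Cantor set -/

theorem gClaim1_of_notMem {x : ℝ} (hx : x ∉ gapUnion (cantorLen 1)) : gClaim1 x = 0 :=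
  gapwise_of_notMem _ hx

/-- The parabola in factored form; `4 * 9 ^ (k + 1)` is `4 / (r - l) ^ 2`. -/
theorem gClaim1_eq_of_mem_gap {x : ℝ} {k i : ℕ} (hi : i < 2 ^ k)
    (hx : x ∈ gap (cantorLen 1) k i) :
    gClaim1 x = (1 / 2 ^ (k + 1)) *
      (4 * 9 ^ (k + 1) * ((x - gapLeft (cantorLen 1) k i) *
        (gapRight (cantorLen 1) k i - x))) := by
  have H := isCantorLength_cantorLen_one
  rw [gClaim1, gapwise_eq H.pos H.rem_pos _ hi hx]
  simp only [gapRight, cantorLen]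
  have : (9 : ℝ) ^ (k + 1) = 3 ^ (k + 1) * 3 ^ (k + 1) := by rw [← mul_pow]; norm_num
  rw [this]
  field_simp
  ring

theorem differentiableAt_gClaim1_of_mem_gap {x : ℝ} {k i : ℕ} (hi : i < 2 ^ k)
    (hx : x ∈ gap (cantorLen 1) k i) : DifferentiableAt ℝ gClaim1 x := by
  have h : DifferentiableAt ℝ (fun x => (1 / 2 ^ (k + 1)) *
      (4 * 9 ^ (k + 1) * ((x - gapLeft (cantorLen 1) k i) *
        (gapRight (cantorLen 1) k i - x)))) x := by fun_prop
  refine h.congr_of_eventuallyEq ?_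
  filter_upwards [isOpen_Ioo.mem_nhds hx] with y hy using gClaim1_eq_of_mem_gap hi hy

/-- For continuity at `x` off the gaps: the height bound handles gaps of late steps, the linear
bound those of early steps. The latter holds because an end of the gap separates `y` from `x`. -/
theorem gClaim1_bounds {x y : ℝ} {k i : ℕ} (hi : i < 2 ^ k) (hy : y ∈ gap (cantorLen 1) k i)
    (hx : x ∉ gap (cantorLen 1) k i) :
    0 ≤ gClaim1 y ∧ gClaim1 y ≤ (1 / 2) ^ (k + 1) ∧ gClaim1 y ≤ 4 * 3 ^ (k + 1) * |y - x| := by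
  rw [gClaim1_eq_of_mem_gap hi hy]
  have h1 := sub_pos.2 hy.1
  have h2 := sub_pos.2 hy.2
  set s := y - gapLeft (cantorLen 1) k i with hs
  set t := gapRight (cantorLen 1) k i - y with ht
  have hst : s + t = 1 / 3 ^ (k + 1) := by
    rw [hs, ht, gapRight, cantorLen]; ring
  have h3 : (0 : ℝ) < 3 ^ (k + 1) := by positivity
  have h9 : (9 : ℝ) ^ (k + 1) = 3 ^ (k + 1) * 3 ^ (k + 1) := by rw [← mul_pow]; norm_num
  have hmul : (s + t) * 3 ^ (k + 1) = 1 := by rw [hst]; field_simp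
  have hxd : s ≤ |y - x| ∨ t ≤ |y - x| := by
    by_cases hl : x ≤ gapLeft (cantorLen 1) k i
    · left; rw [hs]; refine le_trans ?_ (le_abs_self _); linarith
    · right
      have : gapRight (cantorLen 1) k i ≤ x := not_lt.1 fun h => hx ⟨not_le.1 hl, h⟩
      rw [ht]; refine le_trans ?_ (neg_le_abs _); linarith
  have h2k : (1 : ℝ) / 2 ^ (k + 1) ≤ 1 := by
    rw [div_le_one (by positivity)]; exact one_le_pow₀ (by norm_num)
  have hp : 0 < 4 * 9 ^ (k + 1) * (s * t) := by positivity
  refine ⟨by positivity, ?_, ?_⟩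
  · rw [div_pow, one_pow]
    refine mul_le_of_le_one_right (by positivity) ?_
    rw [h9]
    -- This is `4 * s * t ≤ (s + t) ^ 2`, rescaled so that the right side is 1.
    nlinarith [sq_nonneg ((s - t) * 3 ^ (k + 1))]
  · refine (mul_le_of_le_one_left hp.le h2k).trans ?_
    have hs3 : s * 3 ^ (k + 1) ≤ 1 := by rw [← hmul]; gcongr; linarith
    have ht3 : t * 3 ^ (k + 1) ≤ 1 := by rw [← hmul]; gcongr; linarith
    rw [h9]
    rcases hxd with h | h
    · calc 4 * (3 ^ (k + 1) * 3 ^ (k + 1)) * (s * t)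
          = 4 * 3 ^ (k + 1) * s * (t * 3 ^ (k + 1)) := by ring
        _ ≤ 4 * 3 ^ (k + 1) * s * 1 := by gcongr
        _ ≤ 4 * 3 ^ (k + 1) * |y - x| := by rw [mul_one]; gcongr
    · calc 4 * (3 ^ (k + 1) * 3 ^ (k + 1)) * (s * t)
          = 4 * 3 ^ (k + 1) * t * (s * 3 ^ (k + 1)) := by ring
        _ ≤ 4 * 3 ^ (k + 1) * t * 1 := by gcongr
        _ ≤ 4 * 3 ^ (k + 1) * |y - x| := by rw [mul_one]; gcongr

theorem continuous_gClaim1 : Continuous gClaim1 := by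
  refine continuous_iff_continuousAt.2 fun x => ?_
  by_cases hx : x ∈ gapUnion (cantorLen 1)
  · obtain ⟨k, i, hi, h⟩ := exists_gap_of_mem_gapUnion hx
    exact (differentiableAt_gClaim1_of_mem_gap hi h).continuousAt
  rw [Metric.continuousAt_iff]
  intro ε hε
  obtain ⟨K, hK⟩ := exists_pow_lt_of_lt_one hε (show (1 / 2 : ℝ) < 1 by norm_num)
  -- For `k < K` the linear bound has constant at most `4 * 3 ^ K`; for `k ≥ K` the height is below
  -- `ε`.
  refine ⟨ε / (4 * 3 ^ K), by positivity, fun y hy => ?_⟩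
  rw [gClaim1_of_notMem hx, dist_zero_right, Real.norm_eq_abs]
  rw [Real.dist_eq, lt_div_iff₀ (by positivity)] at hy
  by_cases hyg : y ∈ gapUnion (cantorLen 1)
  · obtain ⟨k, i, hi, h⟩ := exists_gap_of_mem_gapUnion hyg
    obtain ⟨h0, h1, h2⟩ := gClaim1_bounds hi h fun hxg => hx ⟨k, i, hi, hxg⟩
    rw [abs_of_nonneg h0]
    rcases lt_or_ge k K with hk | hk
    · refine h2.trans_lt (lt_of_le_of_lt ?_ hy)
      rw [mul_comm |y - x|]
      gcongr
      · norm_num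
      · omega
    · refine h1.trans_lt (lt_of_le_of_lt ?_ hK)
      exact pow_le_pow_of_le_one (by norm_num) (by norm_num) (by omega)
  · rw [gClaim1_of_notMem hyg, abs_zero]; exact hε

theorem aeDifferentiableOn_gClaim1 : AEDifferentiableOn (Ioo 0 1) gClaim1 := by
  filter_upwards [ae_mem_gapUnion_cantorLen_one] with x hx
  obtain ⟨k, i, hi, h⟩ := exists_gap_of_mem_gapUnion hx
  exact differentiableAt_gClaim1_of_mem_gap hi h

theorem gClaim1_gapMid {k i : ℕ} (hi : i < 2 ^ k) :
    gClaim1 ((gapLeft (cantorLen 1) k i + gapRight (cantorLen 1) k i) / 2)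
      = (1 / 2) ^ (k + 1) := by
  rw [gClaim1_eq_of_mem_gap hi (isCantorLength_cantorLen_one.gapMid_mem k i)]
  have h9 : (9 : ℝ) ^ (k + 1) = 3 ^ (k + 1) * 3 ^ (k + 1) := by rw [← mul_pow]; norm_num
  rw [h9, gapRight, cantorLen, div_pow]
  field_simp
  ring

/-- Differentiability would give `|g y| ≤ C * |y - x|` near `x`, but within `1 / 3 ^ k` of `x` there
is a peak of height `1 / 2 ^ (k + 1)`. -/
theorem not_differentiableAt_gClaim1 {x : ℝ}
    (hx : x ∈ Ioo (0 : ℝ) 1 \ gapUnion (cantorLen 1)) : ¬ DifferentiableAt ℝ gClaim1 x := by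
  intro hd
  have H := isCantorLength_cantorLen_one
  obtain ⟨i, hi, hax, hxb, ha, hb⟩ := H.exists_seq hx
  obtain ⟨C, hC⟩ := hd.hasDerivAt.isBigO_sub.bound
  set m : ℕ → ℝ := fun k =>
    (gapLeft (cantorLen 1) k (i k) + gapRight (cantorLen 1) k (i k)) / 2 with hm
  have hmem : ∀ k, remLeft (cantorLen 1) k (i k) ≤ m k ∧
      m k ≤ remLeft (cantorLen 1) k (i k) + remLength (cantorLen 1) k := fun k => by
    have h1 := H.remLeft_lt_gapLeft k (i k)
    have h2 := H.gapRight_lt k (i k)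
    have h3 := H.gapLeft_lt_gapRight k (i k)
    simp only [hm]
    constructor <;> linarith
  have hmx : Tendsto m atTop (𝓝 x) := tendsto_of_tendsto_of_tendsto_of_le_of_le ha hb
    (fun k => (hmem k).1) (fun k => (hmem k).2)
  obtain ⟨k, hk, hk'⟩ := ((hmx.eventually hC).and
    (tendsto_three_halves_pow_atTop.eventually (eventually_gt_atTop (2 * |C|)))).exists
  rw [gClaim1_of_notMem hx.2, sub_zero, hm, gClaim1_gapMid (hi k), Real.norm_eq_abs,
    Real.norm_eq_abs, abs_of_pos (by positivity)] at hk
  have hdist : |m k - x| ≤ 1 / 3 ^ k := by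
    rw [← remLength_cantorLen_one, abs_le]
    constructor <;> linarith [hax k, hxb k, (hmem k).1, (hmem k).2]
  have h1 : (1 / 2 : ℝ) ^ (k + 1) ≤ |C| * (1 / 3 ^ k) :=
    hk.trans (mul_le_mul (le_abs_self C) hdist (abs_nonneg _) (abs_nonneg _))
  rw [mul_one_div, le_div_iff₀ (by positivity)] at h1
  have h2 : (1 / 2 : ℝ) ^ (k + 1) * 3 ^ k = (3 / 2) ^ k / 2 := by
    rw [pow_succ, div_pow, div_pow, one_pow]; ring
  linarith

/-! ## Volterra's function -/

theorem abs_volterraOsc_le (y : ℝ) : |volterraOsc y| ≤ y ^ 2 := by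
  rw [volterraOsc, abs_mul, abs_of_nonneg (sq_nonneg y)]
  exact mul_le_of_le_one_right (sq_nonneg y) (Real.abs_sin_le_one _)

theorem hasDerivAt_volterraOsc {y : ℝ} (hy : y ≠ 0) :
    HasDerivAt volterraOsc (2 * y * Real.sin (1 / y) - Real.cos (1 / y)) y := by
  have h1 : HasDerivAt (fun y : ℝ => 1 / y) (-(y ^ 2)⁻¹) y := by
    simpa only [one_div] using hasDerivAt_inv hy
  have h := (hasDerivAt_pow 2 y).mul h1.sin
  refine h.congr_deriv ?_
  field_simp
  push_cast
  ring

theorem hasDerivAt_zero_of_abs_sub_le_sq {f : ℝ → ℝ} {x : ℝ}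
    (h : ∀ y, |f y - f x| ≤ (y - x) ^ 2) : HasDerivAt f 0 x := by
  rw [hasDerivAt_iff_isLittleO]
  simp only [smul_zero, sub_zero]
  have h1 : (fun y => f y - f x) =O[𝓝 x] fun y => (y - x) ^ 2 :=
    Asymptotics.IsBigO.of_bound 1 (Eventually.of_forall fun y => by
      rw [one_mul, Real.norm_eq_abs, Real.norm_eq_abs, abs_of_nonneg (sq_nonneg (y - x))]
      exact h y)
  refine h1.trans_isLittleO ?_
  simpa only [Real.norm_eq_abs, sq_abs] using Asymptotics.isLittleO_pow_sub_sub x one_lt_two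

theorem differentiable_volterraOsc : Differentiable ℝ volterraOsc := fun y => by
  rcases eq_or_ne y 0 with rfl | hy
  · refine (hasDerivAt_zero_of_abs_sub_le_sq fun y => ?_).differentiableAt
    simpa [volterraOsc] using abs_volterraOsc_le y
  · exact (hasDerivAt_volterraOsc hy).differentiableAt

theorem volterraOsc_one_div_nat_mul_pi (n : ℕ) : volterraOsc (1 / (n * Real.pi)) = 0 := by
  rw [volterraOsc, one_div_one_div, Real.sin_nat_mul_pi, mul_zero]

/-- Rolle's theorem between the zeros `1 / ((n + 1) * π)` and `1 / (n * π)`. The supremum in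
`volterraCut` is thus over a nonempty set and not a default value. -/
theorem exists_critical_volterraOsc {d : ℝ} (hd : 0 < d) :
    ∃ y, 0 < y ∧ y ≤ d / 2 ∧ deriv volterraOsc y = 0 := by
  obtain ⟨n, hn⟩ := exists_nat_gt (2 / d)
  have hn0 : (0 : ℝ) < n := (by positivity : 0 < 2 / d).trans hn
  have hpi := Real.pi_pos
  have hlt : 1 / (((n + 1 : ℕ) : ℝ) * Real.pi) < 1 / (n * Real.pi) := by
    gcongr; linarith
  obtain ⟨y, hy, hy'⟩ := exists_deriv_eq_zero hlt
    differentiable_volterraOsc.continuous.continuousOn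
    ((volterraOsc_one_div_nat_mul_pi _).trans (volterraOsc_one_div_nat_mul_pi n).symm)
  refine ⟨y, lt_trans (by positivity) hy.1, hy.2.le.trans ?_, hy'⟩
  rw [div_lt_iff₀ hd] at hn
  rw [div_le_div_iff₀ (by positivity) two_pos]
  nlinarith [Real.pi_gt_three, mul_pos hn0 hd]

theorem volterraCut_pos {d : ℝ} (hd : 0 < d) : 0 < volterraCut d := by
  obtain ⟨y, h0, h1, h2⟩ := exists_critical_volterraOsc hd
  exact h0.trans_le (le_csSup ⟨d / 2, fun _ h => h.2.1⟩ ⟨h0, h1, h2⟩)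

theorem volterraCut_le {d : ℝ} (hd : 0 < d) : volterraCut d ≤ d / 2 :=
  csSup_le (exists_critical_volterraOsc hd) fun _ h => h.2.1

/-- At `y = 1 / (2 * π * n)` the sine vanishes and the cosine is 1. -/
theorem exists_deriv_volterraOsc_eq_neg_one {c : ℝ} (hc : 0 < c) :
    ∃ y, 0 < y ∧ y < c ∧ HasDerivAt volterraOsc (-1) y := by
  obtain ⟨n, hn⟩ := exists_nat_gt (1 / c)
  have hn0 : (0 : ℝ) < n := (by positivity : 0 < 1 / c).trans hn
  have hpi := Real.pi_pos
  refine ⟨1 / (n * (2 * Real.pi)), by positivity, ?_, ?_⟩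
  · rw [div_lt_iff₀ hc] at hn
    rw [div_lt_iff₀ (by positivity)]
    nlinarith [Real.pi_gt_three, mul_pos hn0 hc]
  · refine (hasDerivAt_volterraOsc (by positivity)).congr_deriv ?_
    rw [one_div_one_div, Real.cos_nat_mul_two_pi]
    have : Real.sin (n * (2 * Real.pi)) = 0 := by
      have := Real.sin_nat_mul_pi (n * 2)
      push_cast at this
      rwa [mul_assoc] at this
    rw [this]; ring

/-- Volterra's function on a removed interval `(a, b)`, with cutting point `c`. -/
noncomputable def volterraPiece (a b c x : ℝ) : ℝ :=
  if x ≤ a + c then volterraOsc (x - a)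
  else if x ≤ b - c then volterraOsc c
  else volterraOsc (b - x)

theorem continuous_volterraPiece {a b c : ℝ} (hc : c ≤ (b - a) / 2) :
    Continuous (volterraPiece a b c) := by
  have ho := differentiable_volterraOsc.continuous
  refine Continuous.if_le (by fun_prop) (Continuous.if_le (by fun_prop) (by fun_prop)
    continuous_id continuous_const ?_) continuous_id continuous_const ?_
  · rintro x rfl; congr 1; ring
  · rintro x rfl
    -- The bound on `c` puts the join `a + c` no later than `b - c`, so the middle branch applies.
    rw [if_pos (by linarith)]
    congr 1; ring

/-- On every branch the argument of `volterraOsc` is at most the distance from `x` to either end, as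
`c` is at most half the length. -/
theorem abs_volterraPiece_le {a b c x : ℝ} (h0 : 0 ≤ c) (hc : c ≤ (b - a) / 2) (ha : a < x)
    (hb : x < b) : |volterraPiece a b c x| ≤ (x - a) ^ 2 ∧
      |volterraPiece a b c x| ≤ (b - x) ^ 2 := by
  rw [volterraPiece]
  split_ifs with h1 h2
  · refine ⟨abs_volterraOsc_le _, (abs_volterraOsc_le _).trans ?_⟩
    exact pow_le_pow_left₀ (by linarith) (by linarith) 2
  · exact ⟨(abs_volterraOsc_le _).trans (pow_le_pow_left₀ h0 (by linarith) 2),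
      (abs_volterraOsc_le _).trans (pow_le_pow_left₀ h0 (by linarith) 2)⟩
  · refine ⟨(abs_volterraOsc_le _).trans ?_, abs_volterraOsc_le _⟩
    exact pow_le_pow_left₀ (by linarith) (by linarith) 2

theorem volterraPiece_eventuallyEq_left {a b c x : ℝ} (hx : x < a + c) :
    volterraPiece a b c =ᶠ[𝓝 x] fun x => volterraOsc (x - a) := by
  filter_upwards [gt_mem_nhds hx] with y hy
  rw [volterraPiece, if_pos (le_of_lt hy)]

theorem differentiableAt_volterraPiece {a b c x : ℝ} (h1 : x ≠ a + c)
    (h2 : x ≠ b - c) : DifferentiableAt ℝ (volterraPiece a b c) x := by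
  have ho := differentiable_volterraOsc
  rcases h1.lt_or_gt with h1 | h1
  · have h : DifferentiableAt ℝ (fun x => volterraOsc (x - a)) x := by fun_prop
    exact h.congr_of_eventuallyEq (volterraPiece_eventuallyEq_left h1)
  rcases h2.lt_or_gt with h2 | h2
  · refine (differentiableAt_const (volterraOsc c)).congr_of_eventuallyEq ?_
    filter_upwards [lt_mem_nhds h1, gt_mem_nhds h2] with y hy1 hy2
    rw [volterraPiece, if_neg (not_le.2 hy1), if_pos (le_of_lt hy2)]
  · have h : DifferentiableAt ℝ (fun x => volterraOsc (b - x)) x := by fun_prop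
    refine h.congr_of_eventuallyEq ?_
    filter_upwards [lt_mem_nhds h1, lt_mem_nhds h2] with y hy1 hy2
    rw [volterraPiece, if_neg (not_le.2 hy1), if_neg (not_le.2 hy2)]

namespace IsCantorLength

variable {ℓ : ℕ → ℝ} (H : IsCantorLength ℓ)
include H

theorem volterraCut_gap (k i : ℕ) : 0 < volterraCut (gapRight ℓ k i - gapLeft ℓ k i) ∧
    volterraCut (gapRight ℓ k i - gapLeft ℓ k i) ≤ (gapRight ℓ k i - gapLeft ℓ k i) / 2 :=
  ⟨volterraCut_pos (sub_pos.2 (H.gapLeft_lt_gapRight k i)),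
    volterraCut_le (sub_pos.2 (H.gapLeft_lt_gapRight k i))⟩

theorem volterraFunction_eventuallyEq {x : ℝ} {k i : ℕ} (hi : i < 2 ^ k) (hx : x ∈ gap ℓ k i) :
    volterraFunction ℓ =ᶠ[𝓝 x] volterraPiece (gapLeft ℓ k i) (gapRight ℓ k i)
      (volterraCut (gapRight ℓ k i - gapLeft ℓ k i)) :=
  H.gapwise_eventuallyEq _ hi hx

/-- For `y` in a gap, some end of the gap lies between `x` and `y`, and `|V y|` is at most the
squared distance from `y` to it; so `|V y| ≤ (y - x) ^ 2`. -/
theorem hasDerivAt_volterraFunction_of_notMem {x : ℝ} (hx : x ∉ gapUnion ℓ) :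
    HasDerivAt (volterraFunction ℓ) 0 x := by
  refine hasDerivAt_zero_of_abs_sub_le_sq fun y => ?_
  rw [volterraFunction, gapwise_of_notMem _ hx, sub_zero, ← volterraFunction]
  by_cases hy : y ∈ gapUnion ℓ
  · obtain ⟨k, i, hi, h⟩ := exists_gap_of_mem_gapUnion hy
    obtain ⟨c0, c1⟩ := H.volterraCut_gap k i
    rw [(H.volterraFunction_eventuallyEq hi h).self_of_nhds]
    have hb := abs_volterraPiece_le c0.le c1 h.1 h.2
    by_cases hl : x ≤ gapLeft ℓ k i
    · exact hb.1.trans (pow_le_pow_left₀ (sub_pos.2 h.1).le (by linarith) 2)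
    · have hr : gapRight ℓ k i ≤ x := not_lt.1 fun h' => hx ⟨k, i, hi, not_le.1 hl, h'⟩
      refine hb.2.trans ?_
      rw [← neg_sub x y, neg_sq]
      exact pow_le_pow_left₀ (sub_pos.2 h.2).le (by linarith) 2
  · rw [volterraFunction, gapwise_of_notMem _ hy, abs_zero]
    exact sq_nonneg _

theorem continuous_volterraFunction : Continuous (volterraFunction ℓ) := by
  refine continuous_iff_continuousAt.2 fun x => ?_
  by_cases hx : x ∈ gapUnion ℓ
  · obtain ⟨k, i, hi, h⟩ := exists_gap_of_mem_gapUnion hx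
    exact (continuous_volterraPiece (H.volterraCut_gap k i).2).continuousAt.congr
      (H.volterraFunction_eventuallyEq hi h).symm
  · exact (H.hasDerivAt_volterraFunction_of_notMem hx).continuousAt

/-- The cut points are countably many and are discarded, so criticality of `c` is not needed here.
-/
theorem aeDifferentiableOn_volterraFunction (X : Set ℝ) :
    AEDifferentiableOn X (volterraFunction ℓ) := by
  let c : ℕ × ℕ → ℝ := fun p => volterraCut (gapRight ℓ p.1 p.2 - gapLeft ℓ p.1 p.2)
  refine ae_restrict_of_ae ?_
  filter_upwards [(countable_range fun p => gapLeft ℓ p.1 p.2 + c p).ae_notMem volume,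
    (countable_range fun p => gapRight ℓ p.1 p.2 - c p).ae_notMem volume] with x h1 h2
  by_cases hx : x ∈ gapUnion ℓ
  · obtain ⟨k, i, hi, h⟩ := exists_gap_of_mem_gapUnion hx
    refine (differentiableAt_volterraPiece (fun e => h1 ⟨(k, i), e.symm⟩)
      fun e => h2 ⟨(k, i), e.symm⟩).congr_of_eventuallyEq (H.volterraFunction_eventuallyEq hi h)
  · exact (H.hasDerivAt_volterraFunction_of_notMem hx).differentiableAt

theorem exists_deriv_volterraFunction_eq_neg_one {k i : ℕ} (hi : i < 2 ^ k) :
    ∃ y ∈ gap ℓ k i, HasDerivAt (volterraFunction ℓ) (-1) y := by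
  obtain ⟨c0, c1⟩ := H.volterraCut_gap k i
  obtain ⟨t, ht0, htc, ht⟩ := exists_deriv_volterraOsc_eq_neg_one c0
  have hlr := H.gapLeft_lt_gapRight k i
  have hmem : gapLeft ℓ k i + t ∈ gap ℓ k i := ⟨by linarith, by linarith⟩
  refine ⟨_, hmem, ?_⟩
  have hd : HasDerivAt (fun x => volterraOsc (x - gapLeft ℓ k i)) (-1) (gapLeft ℓ k i + t) :=
    HasDerivAt.comp_sub_const _ _ (by rwa [add_sub_cancel_left])
  exact (hd.congr_of_eventuallyEq
    (volterraPiece_eventuallyEq_left (by linarith))).congr_of_eventuallyEq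
    (H.volterraFunction_eventuallyEq hi hmem)

theorem volume_derivDefectSet_volterraFunction_pos {q : ℝ} (hq0 : 0 ≤ q) (hq : q < 1)
    (hℓ : ∀ k, ℓ (k + 1) ≤ q / 3 ^ (k + 1)) :
    0 < volume (derivDefectSet (Ioo 0 1) (volterraFunction ℓ)) := by
  refine volume_pos_of_notMem_gapUnion hq0 hq hℓ fun x hx => ?_
  refine mem_derivDefectSet_of_frequently (c := -1) hx.1 (fun _ => ?_) fun ε hε => ?_
  · rw [(H.hasDerivAt_volterraFunction_of_notMem hx.2).deriv]; norm_num
  · obtain ⟨k, i, hi, hk⟩ := H.exists_gap_near hx hε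
    obtain ⟨y, hy, hdy⟩ := H.exists_deriv_volterraFunction_eq_neg_one hi
    exact ⟨y, H.gap_subset hi hy, hk y hy, hdy⟩

end IsCantorLength

/-! ### Uncountable non-differentiability and the final assembly -/

theorem not_countable_nondiffSet_of_cantorSet_one {h : ℝ → ℝ}
    (hh : ∀ x ∈ Ioo (0 : ℝ) 1 \ gapUnion (cantorLen 1), ¬ DifferentiableAt ℝ h x) :
    ¬ (nondiffSet (Ioo 0 1) h).Countable := by
  have hsub : Ioo (0 : ℝ) 1 \ gapUnion (cantorLen 1) ⊆ nondiffSet (Ioo 0 1) h :=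
    fun x hx => ⟨hx.1, hh x hx⟩
  exact fun hc => not_countable_cantorSet_one (hc.mono hsub)

theorem not_countable_nondiffSet_cantorFunction_one :
    ¬ (nondiffSet (Ioo 0 1) (cantorFunction 1)).Countable :=
  not_countable_nondiffSet_of_cantorSet_one fun _ => not_differentiableAt_cantorFunction_one

theorem not_countable_nondiffSet_gClaim1 : ¬ (nondiffSet (Ioo 0 1) gClaim1).Countable :=
  not_countable_nondiffSet_of_cantorSet_one fun _ => not_differentiableAt_gClaim1

theorem not_isPAP_cantorFunction {lam : ℝ} (h : lam ∈ Ioc (0 : ℝ) 1) :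
    ¬ IsPAP (Ioo 0 1) (cantorFunction lam) := by
  rcases h.2.lt_or_eq with h1 | rfl
  · exact not_isPAP_of_derivDefectSet (volume_derivDefectSet_cantorFunction_pos ⟨h.1, h1⟩)
  · exact fun hh => not_countable_nondiffSet_cantorFunction_one hh.countable_nondiffSet

end PAP

theorem mainTheorem9 :
    -- the `lam`-Cantor functions
    (∀ lam ∈ Set.Ioc (0 : ℝ) 1,
      ContinuousOn (PAP.cantorFunction lam) (Set.Ioo 0 1) ∧
      PAP.AEDifferentiableOn (Set.Ioo 0 1) (PAP.cantorFunction lam) ∧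
      ¬ PAP.IsPAP (Set.Ioo (0 : ℝ) 1) (PAP.cantorFunction lam)) ∧
    (∀ lam ∈ Set.Ioo (0 : ℝ) 1,
      0 < MeasureTheory.volume
        (PAP.derivDefectSet (Set.Ioo 0 1) (PAP.cantorFunction lam))) ∧
    ¬ (PAP.nondiffSet (Set.Ioo 0 1) (PAP.cantorFunction 1)).Countable ∧
    -- the two functions whose composition is not almost everywhere differentiable
    (ContinuousOn PAP.fClaim1 (Set.Ioo 0 1) ∧
      PAP.AEDifferentiableOn (Set.Ioo 0 1) PAP.fClaim1 ∧
      ¬ PAP.IsPAP (Set.Ioo (0 : ℝ) 1) PAP.fClaim1 ∧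
      0 < MeasureTheory.volume (PAP.derivDefectSet (Set.Ioo 0 1) PAP.fClaim1)) ∧
    (ContinuousOn PAP.gClaim1 (Set.Ioo 0 1) ∧
      PAP.AEDifferentiableOn (Set.Ioo 0 1) PAP.gClaim1 ∧
      ¬ PAP.IsPAP (Set.Ioo (0 : ℝ) 1) PAP.gClaim1 ∧
      ¬ (PAP.nondiffSet (Set.Ioo 0 1) PAP.gClaim1).Countable) ∧
    -- Volterra's function, for the Smith-Volterra-Cantor set and for the fat `lam`-Cantor sets
    (∀ len : ℕ → ℝ, (len = PAP.svcLen ∨ ∃ lam ∈ Set.Ioo (0 : ℝ) 1, len = PAP.cantorLen lam) →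
      ContinuousOn (PAP.volterraFunction len) (Set.Ioo 0 1) ∧
      PAP.AEDifferentiableOn (Set.Ioo 0 1) (PAP.volterraFunction len) ∧
      ¬ PAP.IsPAP (Set.Ioo (0 : ℝ) 1) (PAP.volterraFunction len) ∧
      0 < MeasureTheory.volume
        (PAP.derivDefectSet (Set.Ioo 0 1) (PAP.volterraFunction len))) := by
  -- Both families of lengths fit one bound `q / 3 ^ k`, with `q = 3 / 4` and `q = lam`.
  have vol : ∀ (len : ℕ → ℝ) (q : ℝ), PAP.IsCantorLength len → 0 ≤ q → q < 1 →
      (∀ k, len (k + 1) ≤ q / 3 ^ (k + 1)) →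
      ContinuousOn (PAP.volterraFunction len) (Set.Ioo 0 1) ∧
      PAP.AEDifferentiableOn (Set.Ioo 0 1) (PAP.volterraFunction len) ∧
      ¬ PAP.IsPAP (Set.Ioo (0 : ℝ) 1) (PAP.volterraFunction len) ∧
      0 < MeasureTheory.volume
        (PAP.derivDefectSet (Set.Ioo 0 1) (PAP.volterraFunction len)) :=
    fun len q H h0 h1 hle =>
      have hpos := H.volume_derivDefectSet_volterraFunction_pos h0 h1 hle
      ⟨H.continuous_volterraFunction.continuousOn, H.aeDifferentiableOn_volterraFunction _,
        PAP.not_isPAP_of_derivDefectSet hpos, hpos⟩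
  refine ⟨fun lam h => ⟨PAP.continuousOn_cantorFunction h,
      PAP.aeDifferentiableOn_cantorFunction h, PAP.not_isPAP_cantorFunction h⟩,
    fun lam h => PAP.volume_derivDefectSet_cantorFunction_pos h,
    PAP.not_countable_nondiffSet_cantorFunction_one,
    ⟨PAP.continuousOn_fClaim1,
      PAP.aeDifferentiableOn_of_monotoneOn isOpen_Ioo PAP.strictMonoOn_fClaim1.monotoneOn,
      PAP.not_isPAP_of_derivDefectSet PAP.volume_derivDefectSet_fClaim1_pos,
      PAP.volume_derivDefectSet_fClaim1_pos⟩,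
    ⟨PAP.continuous_gClaim1.continuousOn, PAP.aeDifferentiableOn_gClaim1,
      fun hh => PAP.not_countable_nondiffSet_gClaim1 hh.countable_nondiffSet,
      PAP.not_countable_nondiffSet_gClaim1⟩, ?_⟩
  rintro len (rfl | ⟨lam, h, rfl⟩)
  · exact vol _ _ PAP.isCantorLength_svcLen (by norm_num) (by norm_num) PAP.svcLen_le
  · exact vol _ _ (PAP.isCantorLength_cantorLen (Ioo_subset_Ioc_self h)) h.1.le h.2
      fun _ => le_rfl
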